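/- **Setting.** Let $\alpha_v=\{a_+,a_-,b_+,b_-\}$. An $n$-component *nanophrase* over $\alpha_v$ is a finite alphabet $\mathcal A$ with a map $A\mapsto|A|\in\alpha_v$ and a phrase $p=w_1|w_2|\cdots|w_n$ of words on $\mathcal A$ in which every letter of $\mathcal A$ occurs exactly twice in total. Let $\tau_v,\nu_v,\sigma_v$ be the involutions of $\alpha_v$ with $\tau_v:a_\pm\leftrightarrow b_\mp$, $\nu_v:a_\pm\leftrightarrow b_\pm$, $\sigma_v:a_+\leftrightarrow a_-,\ b_+\leftrightarrow b_-$, and let $S'_w\subset(\alpha_v\cup\{\emptyset\})^3$ be the set of the 24 triples $$\begin{gathered}(a_\pm,a_\pm,a_\pm),\ (a_\pm,a_\pm,a_\mp),\ (a_\pm,a_\mp,a_\mp),\ (b_\pm,b_\pm,b_\pm),\ (b_\pm,b_\pm,b_\mp),\ (b_\pm,b_\mp,b_\mp),\\ (a_+,a_+,\emptyset),(a_+,b_-,\emptyset),(b_-,a_+,\emptyset),(b_-,b_-,\emptyset),\\ (a_-,\emptyset,b_-),(b_+,\emptyset,a_+),(a_-,\emptyset,a_+),(b_+,\emptyset,b_-),\\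 (\emptyset,a_-,a_-),(\emptyset,a_-,b_+),(\emptyset,b_+,a_-),(\emptyset,b_+,b_+).\end{gathered}$$ *Extended $M$-homotopy* is the equivalence relation on $n$-component nanophrases over $\alpha_v$ generated by isomorphisms (bijections of alphabets that preserve $|\cdot|$ and carry each component letterwise to the corresponding component) and the following moves, where $x,y,z,t$ are arbitrary sequences of letters and bars: * H1: $(\mathcal A,xAAy)\leftrightarrow(\mathcal A\setminus\{A\},xy)$; * H2: $(\mathcal A,xAByBAz)\leftrightarrow(\mathcal A\setminus\{A,B\},xyz)$ if $\tau_v(|A|)=|B|$; * (extended) H3: $(\mathcal A,xAByACzBCt)\leftrightarrow(\mathcal A,xBAyCAzCBt)$ if $(|A|,|B|,|C|)\in S'_w$, where each of $A,B,C$ is a letter or the empty word $\emptyset$, and $|\emptyset|=\emptyset$; * self crossing: if a letter $A$ occurs twice in the same component, replace $|A|$ by $\sigma_v(|A|)$; * shift: replace a component $Ax$ by $xA$ and, if $x$ contains $A$, replace $|A|$ by $\nu_v(|A|)$. **The invariant.** For an occurrence of a letter $A$ in $w_i$ whose other occurrence is in $w_k$, let its sign be $\varepsilon=1$ if ($i<k$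 and $|A|=b_+$) or ($i>k$ and $|A|=a_+$), $\varepsilon=-1$ if ($i<k$ and $|A|=a_-$) or ($i>k$ and $|A|=b_-$), and $\varepsilon=0$ otherwise. Let $w_i^\varepsilon$ be the word on $\mathcal A\cup\mathcal A^{-1}$ obtained from $w_i$ by giving each occurrence its sign as exponent, where $A^0$ is the empty word. Let $\eta(A^{\pm1})=a_k^{\pm1}$, where $w_k$ is the component containing the second occurrence of $A$ in $p$ if $|A|\in\{b_+,a_-\}$, and the first one if $|A|\in\{a_+,b_-\}$. If the two occurrences of $A$ are in different components, let $x_A$ be the part of $w_k^\varepsilon$, with this $k$, that precedes the occurrence of $A$ in $w_k$. On words in such signed letters let $\rho^2=\mathrm{id}$ and, for $q\ge3$, let $\rho^q$ be the concatenation-preserving map with $\rho^q(A^{\pm1})=\rho^{q-1}(x_A^{-1})\,A^{\pm1}\,\rho^{q-1}(x_A)$. Let $\varphi$ be the multiplicative map from words in $a_1^{\pm1},\dots,a_n^{\pm1}$ to the ring of formal power series over $\mathbb Z$ in noncommuting variables $\kappa_1,\dots,\kappa_n$ with $\varphi(a_h)=1+\kappa_h$ and $\varphi(a_h^{-1})=1-\kappa_h+\kappa_h^2-\cdots$.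 The coefficients of $\varphi\circ\eta(\rho^q(w_i^\varepsilon))$ are eventually constant as $q\to\infty$; for $u\ge1$ let $\mu(p;c_1,\dots,c_u,i)$ be the limit of the coefficient of $\kappa_{c_1}\cdots\kappa_{c_u}$. Let $\Delta(p;c_1,\dots,c_u,i)$ be the greatest common divisor of the numbers $\mu(p;d_1,\dots,d_t)$ over all sequences $d_1,\dots,d_t$ with $t\ge2$ obtained from $c_1,\dots,c_u,i$ by eliminating at least one index and permuting the remaining ones cyclically ($\Delta=0$ if $u=1$), and let $\bar\mu(p;c_1,\dots,c_u,i)$ be the residue class of $\mu(p;c_1,\dots,c_u,i)$ modulo $\Delta(p;c_1,\dots,c_u,i)$. **Theorem.** Let $u\ge1$ and let $c_1,\dots,c_u,i$ be pairwise distinct integers between $1$ and $n$. If $p$ and $p'$ are $n$-component nanophrases over $\alpha_v$ that are related by extended $M$-homotopy, then $$\bar\mu(p;c_1,\dots,c_u,i)=\bar\mu(p';c_1,\dots,c_u,i),$$ that is, $\Delta(p;c_1,\dots,c_u,i)=\Delta(p';c_1,\dots,c_u,i)$ and $\mu(p;c_1,\dots,c_u,i)\equiv\mu(p';c_1,\dots,c_u,i)$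 modulo this number. -/

import Mathlib

universe u

/-! ### Words, phrases and nanophrases -/

/-- The symbols used to write a phrase in one line: letters, and the bar `|` that separates
consecutive components. -/
inductive Token (L : Type u) : Type u
  | letter (A : L) : Token L
  | bar : Token L

namespace Token

/-- Apply a map of letters to a symbol. -/
def map {L L' : Type u} (f : L → L') : Token L → Token L'
  | letter A => letter (f A)
  | bar => bar

/-- An element of `L ∪ {∅}` (a letter, or the empty word `none`) as a sequence of symbols. -/
def ofOption {L : Type u} : Option L → List (Token L)
  | some A => [letter A]
  | none => []

end Token

/-- The phrase `w₁|w₂|⋯|wₙ` written in one line. -/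
def flatPhrase {L : Type u} {n : ℕ} (w : Fin n → List L) : List (Token L) :=
  [Token.bar].intercalate (List.ofFn fun k => (w k).map Token.letter)

/-- `w₁|⋯|wₙ` is a Gauss phrase on the alphabet `L`: every letter of `L` occurs exactly twice in
the concatenation `w₁⋯wₙ`. -/
def IsGauss {L : Type u} [DecidableEq L] {n : ℕ} (w : Fin n → List L) : Prop :=
  ∀ A : L, (List.ofFn w).flatten.count A = 2

/-- An `n`-component nanophrase over `α`: an alphabet with a projection to `α`, and an
`n`-component Gauss phrase on it. (The alphabet is finite because of the Gauss condition,
see `Nanophrase.finite_letter`.) -/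
structure Nanophrase (α : Type*) (n : ℕ) where
  /-- the alphabet -/
  Letter : Type u
  /-- equality of letters is decidable -/
  [dec : DecidableEq Letter]
  /-- the projection `A ↦ |A|` -/
  proj : Letter → α
  /-- the components -/
  word : Fin n → List Letter
  gauss : IsGauss word

attribute [instance] Nanophrase.dec

theorem Nanophrase.finite_letter {α : Type*} {n : ℕ} (p : Nanophrase.{u} α n) :
    Finite p.Letter := by
  have h : ∀ A : p.Letter, A ∈ (List.ofFn p.word).flatten.toFinset := by
    intro A
    have hA := p.gauss A
    rw [List.mem_toFinset]
    exact List.count_pos_iff.1 (by omega)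
  have hu : (Set.univ : Set p.Letter) ⊆ ((List.ofFn p.word).flatten.toFinset : Set p.Letter) :=
    fun A _ => h A
  exact Set.finite_univ_iff.1 ((Finset.finite_toSet _).subset hu)

/-! ### Extended `M`-homotopy -/

/-- The data on which an extended `M`-homotopy depends: involutions `τ`, `ν`, `σ` of `α` and a
subset `S'` of `(α ∪ {∅})³`; the element `∅` is `none`. -/
structure ExtHomotopyData (α : Type*) where
  /-- the involution of the second homotopy move -/
  τ : α → α
  /-- the involution of the shift move -/
  ν : α → α
  /-- the involution of the self crossing move -/
  σ : α → α
  τ_invol : Function.Involutive τ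
  ν_invol : Function.Involutive ν
  σ_invol : Function.Involutive σ
  /-- the triples that allow the (extended) third homotopy move -/
  S' : Set (Option α × Option α × Option α)

/-- The moves that generate extended `M`-homotopy. In `h1`, `h2`, `h3` the lists `x y z t` are
arbitrary sequences of letters and bars. -/
inductive ExtMMove {α : Type*} {n : ℕ} (D : ExtHomotopyData α) :
    Nanophrase.{u} α n → Nanophrase.{u} α n → Prop
  /-- isomorphism: a bijection of alphabets that preserves projections and components -/
  | iso (p p' : Nanophrase.{u} α n) (f : p.Letter ≃ p'.Letter)
      (hproj : ∀ A, p'.proj (f A) = p.proj A)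
      (hword : ∀ k, p'.word k = (p.word k).map f) :
      ExtMMove D p p'
  /-- `(𝒜, xAAy) ⟶ (𝒜 - {A}, xy)` -/
  | h1 (p p' : Nanophrase.{u} α n) (A : p.Letter)
      (f : p'.Letter ≃ {X : p.Letter // X ≠ A})
      (hproj : ∀ X, p'.proj X = p.proj (f X))
      (x y : List (Token p.Letter))
      (hp : flatPhrase p.word = x ++ [.letter A, .letter A] ++ y)
      (hp' : (flatPhrase p'.word).map (Token.map fun X => (f X : p.Letter)) = x ++ y) :
      ExtMMove D p p'
  /-- `(𝒜, xAByBAz) ⟶ (𝒜 - {A, B}, xyz)` if `τ(|A|) = |B|` -/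
  | h2 (p p' : Nanophrase.{u} α n) (A B : p.Letter)
      (hτ : D.τ (p.proj A) = p.proj B)
      (f : p'.Letter ≃ {X : p.Letter // X ≠ A ∧ X ≠ B})
      (hproj : ∀ X, p'.proj X = p.proj (f X))
      (x y z : List (Token p.Letter))
      (hp : flatPhrase p.word =
        x ++ [.letter A, .letter B] ++ y ++ [.letter B, .letter A] ++ z)
      (hp' : (flatPhrase p'.word).map (Token.map fun X => (f X : p.Letter)) = x ++ y ++ z) :
      ExtMMove D p p'
  /-- `(𝒜, xAByACzBCt) ⟶ (𝒜, xBAyCAzCBt)` if `(|A|, |B|, |C|) ∈ S'`, where each of `A`, `B`, `C`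
  is a letter or the empty word. If none is empty, this is the usual third move. -/
  | h3 (L : Type u) [DecidableEq L] (proj : L → α) (w w' : Fin n → List L)
      (hw : IsGauss w) (hw' : IsGauss w') (A B C : Option L)
      (hS : (A.map proj, B.map proj, C.map proj) ∈ D.S')
      (x y z t : List (Token L))
      (hp : flatPhrase w =
        x ++ Token.ofOption A ++ Token.ofOption B ++ y ++ Token.ofOption A ++ Token.ofOption C ++
          z ++ Token.ofOption B ++ Token.ofOption C ++ t)
      (hp' : flatPhrase w' =
        x ++ Token.ofOption B ++ Token.ofOption A ++ y ++ Token.ofOption C ++ Token.ofOption A ++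
          z ++ Token.ofOption C ++ Token.ofOption B ++ t) :
      ExtMMove D ⟨L, proj, w, hw⟩ ⟨L, proj, w', hw'⟩
  /-- self crossing move: a letter that occurs twice in one component changes its projection
  by `σ` -/
  | selfCrossing (L : Type u) [DecidableEq L] (proj : L → α) (w : Fin n → List L)
      (hw : IsGauss w) (k : Fin n) (A : L) (x y z : List L)
      (hk : w k = x ++ [A] ++ y ++ [A] ++ z) :
      ExtMMove D ⟨L, proj, w, hw⟩ ⟨L, Function.update proj A (D.σ (proj A)), w, hw⟩
  /-- shift move: the component `Ax` becomes `xA`, and `|A|` becomes `ν(|A|)` if `x` contains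
  `A`; other projections and components do not change -/
  | shift (L : Type u) [DecidableEq L] (proj : L → α) (w w' : Fin n → List L)
      (hw : IsGauss w) (hw' : IsGauss w') (k : Fin n) (A : L) (x : List L)
      (hk : w k = A :: x) (hk' : w' = Function.update w k (x ++ [A])) :
      ExtMMove D ⟨L, proj, w, hw⟩
        ⟨L, if A ∈ x then Function.update proj A (D.ν (proj A)) else proj, w', hw'⟩

/-- Extended `M`-homotopy: the equivalence relation generated by the moves. -/
def ExtMHomotopic {α : Type*} {n : ℕ} (D : ExtHomotopyData α) :
    Nanophrase.{u} α n → Nanophrase.{u} α n → Prop :=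
  Relation.EqvGen (ExtMMove D)

/-! ### The homotopy data of welded links -/

/-- The set `α_v = {a₊, a₋, b₊, b₋}`. -/
inductive AlphaV : Type
  | ap | am | bp | bm

namespace AlphaV

/-- `τ_v`: `a₊ ↔ b₋`, `a₋ ↔ b₊`. -/
def tau : AlphaV → AlphaV
  | ap => bm | bm => ap | am => bp | bp => am

/-- `ν_v`: `a₊ ↔ b₊`, `a₋ ↔ b₋`. -/
def nu : AlphaV → AlphaV
  | ap => bp | bp => ap | am => bm | bm => am

/-- `σ_v`: `a₊ ↔ a₋`, `b₊ ↔ b₋`. -/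
def sigma : AlphaV → AlphaV
  | ap => am | am => ap | bp => bm | bm => bp

/-- The set `S'_w`. -/
def weldedTriples : Set (Option AlphaV × Option AlphaV × Option AlphaV) :=
  { (some ap, some ap, some ap), (some ap, some ap, some am), (some ap, some am, some am),
    (some am, some am, some am), (some am, some am, some ap), (some am, some ap, some ap),
    (some bp, some bp, some bp), (some bp, some bp, some bm), (some bp, some bm, some bm),
    (some bm, some bm, some bm), (some bm, some bm, some bp), (some bm, some bp, some bp),
    (some ap, some ap, none), (some ap, some bm, none),
    (some bm, some ap, none), (some bm, some bm, none),
    (some am, none, some bm), (some bp, none, some ap),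
    (some am, none, some ap), (some bp, none, some bm),
    (none, some am, some am), (none, some am, some bp),
    (none, some bp, some am), (none, some bp, some bp) }

end AlphaV

/-- The data `(α_v, τ_v, S'_w)`, `ν_v`, `σ_v`. -/
def weldedData : ExtHomotopyData AlphaV where
  τ := AlphaV.tau
  ν := AlphaV.nu
  σ := AlphaV.sigma
  τ_invol := by intro a; cases a <;> rfl
  ν_invol := by intro a; cases a <;> rfl
  σ_invol := by intro a; cases a <;> rfl
  S' := AlphaV.weldedTriples

/-! ### Words on an alphabet and its formal inverses -/

/-- Words on `L ∪ L⁻¹`; the pair `(A, true)` is `A` and `(A, false)` is `A⁻¹`. There is no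
cancellation. -/
abbrev SignedWord (L : Type*) := List (L × Bool)

/-- `(A₁⋯Aₘ)⁻¹ = Aₘ⁻¹⋯A₁⁻¹`. -/
def SignedWord.inv {L : Type*} (w : SignedWord L) : SignedWord L :=
  (w.map fun a => (a.1, !a.2)).reverse

namespace Nanophrase

variable {n : ℕ} (p : Nanophrase.{u} AlphaV n)

/-- The sign `ε` of an occurrence of the letter `A` in the component `i`. It is nonzero only
if the other occurrence of `A` is in another component `k`, and then it depends on `|A|` and on
whether `i < k` or `k < i`. -/
def sign (i : Fin n) (A : p.Letter) : SignType :=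
  if ∃ k, i < k ∧ A ∈ p.word k then
    match p.proj A with
    | .bp => 1
    | .am => -1
    | _ => 0
  else if ∃ k, k < i ∧ A ∈ p.word k then
    match p.proj A with
    | .ap => 1
    | .bm => -1
    | _ => 0
  else 0

/-- The word obtained from a piece `w` of the component `i` by giving each letter `A` the exponent
`ε` (letters with exponent `0` disappear). -/
def signedWord (i : Fin n) (w : List p.Letter) : SignedWord p.Letter :=
  w.flatMap fun A =>
    match p.sign i A with
    | .pos => [(A, true)]
    | .neg => [(A, false)]
    | .zero => []

/-- The components in which `A` occurs. -/
def support (A : p.Letter) : Finset (Fin n) :=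
  Finset.univ.filter fun k => A ∈ p.word k

theorem support_nonempty (A : p.Letter) : (p.support A).Nonempty := by
  have hA : A ∈ (List.ofFn p.word).flatten := List.count_pos_iff.1 (by rw [p.gauss A]; omega)
  obtain ⟨l, hl, hAl⟩ := List.mem_flatten.1 hA
  obtain ⟨k, rfl⟩ := (List.mem_ofFn' _ _).1 hl
  exact ⟨k, by simp [support, hAl]⟩

/-- The index `k` with `η(A) = a_k`: the component of the second occurrence of `A` if `|A|` is `b₊`
or `a₋`, and of the first one if `|A|` is `a₊` or `b₋`. -/
def eta (A : p.Letter) : Fin n :=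
  match p.proj A with
  | .bp | .am => (p.support A).max' (p.support_nonempty A)
  | .ap | .bm => (p.support A).min' (p.support_nonempty A)

/-- The map `η` on words, with values in the words on `a₁^{±1}, …, aₙ^{±1}`. -/
def etaWord (w : SignedWord p.Letter) : SignedWord (Fin n) :=
  w.map fun a => (p.eta a.1, a.2)

/-- The signed word `x` before the occurrence of `A` with sign zero: if `A` occurs with nonzero sign
in the component `i`, its other occurrence is in the component `k = η(A) ≠ i`, and `x` is the
truncation of the signed `k`-th component at that occurrence. -/
def before (A : p.Letter) : SignedWord p.Letter :=
  p.signedWord (p.eta A) ((p.word (p.eta A)).takeWhile fun X => X ≠ A)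

/-- The map `ρ^q` (it matters only for `q ≥ 2`): `ρ²` is the identity, and `ρ^q` replaces each
signed letter `A^{±1}` by `ρ^{q-1}(x⁻¹) A^{±1} ρ^{q-1}(x)`. -/
def rho : ℕ → SignedWord p.Letter → SignedWord p.Letter
  | q + 3, w => w.flatMap fun a =>
      rho (q + 2) (p.before a.1).inv ++ [a] ++ rho (q + 2) (p.before a.1)
  | _, w => w

end Nanophrase

/-! ### Noncommutative power series and the expansion -/

/-- The formal power series with integer coefficients in the noncommuting variables `κ₁, …, κₙ`; the
value at `[c₁, …, c_u]` is the coefficient of `κ_{c₁}⋯κ_{c_u}`. -/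
abbrev NCSeries (n : ℕ) := List (Fin n) → ℤ

namespace NCSeries

variable {n : ℕ}

/-- The series `1`. -/
def one : NCSeries n := fun c => if c = [] then 1 else 0

/-- The product of noncommutative series. -/
def mul (f g : NCSeries n) : NCSeries n := fun c =>
  ∑ j ∈ Finset.range (c.length + 1), f (c.take j) * g (c.drop j)

/-- `φ(a_h) = 1 + κ_h` and `φ(a_h⁻¹) = 1 - κ_h + κ_h² - ⋯`. -/
def phiLetter (a : Fin n × Bool) : NCSeries n := fun c =>
  if a.2 = true then (if c = [] ∨ c = [a.1] then 1 else 0)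
  else (if c = List.replicate c.length a.1 then (-1) ^ c.length else 0)

/-- The multiplicative map `φ` from words on `a₁^{±1}, …, aₙ^{±1}` to series. -/
def phi : SignedWord (Fin n) → NCSeries n
  | [] => one
  | a :: w => mul (phiLetter a) (phi w)

end NCSeries

namespace Nanophrase

variable {n : ℕ} (p : Nanophrase.{u} AlphaV n)

/-- The series `φ ∘ η (ρ^q(w_i^ε))`. -/
def expansion (q : ℕ) (i : Fin n) : NCSeries n :=
  NCSeries.phi (p.etaWord (p.rho q (p.signedWord i (p.word i))))

/-- `μ(p; c₁, …, c_u, i)`: the limit for `q → ∞` of the coefficient of `κ_{c₁}⋯κ_{c_u}` in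
`φ ∘ η (ρ^q(w_i^ε))`. It exists, see `Nanophrase.expansion_eq_mu`. -/
noncomputable def mu (c : List (Fin n)) (i : Fin n) : ℤ :=
  Filter.limUnder Filter.atTop fun q => p.expansion q i c

/-- `μ(p; d₁, …, d_t)`, where the last index `d_t` is in the place of `i`
(the value at the empty sequence is never used). -/
noncomputable def muSeq (d : List (Fin n)) : ℤ :=
  match d.getLast? with
  | some i => p.mu d.dropLast i
  | none => 0

/-- The sequences of length at least two that arise from `s` by eliminating at least one index
and permuting the remaining ones cyclically. -/
def lowerSequences (s : List (Fin n)) : Finset (List (Fin n)) :=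
  (((s.sublists.filter fun d => d.length < s.length).flatMap
    List.cyclicPermutations).filter fun d => 2 ≤ d.length).toFinset

/-- `Δ(p; c₁, …, c_u, i)`: the greatest common divisor of the lower `μ`'s; it is `0` for `u = 1`. -/
noncomputable def delta (c : List (Fin n)) (i : Fin n) : ℤ :=
  (lowerSequences (c ++ [i])).gcd p.muSeq

/-- `μ̄(p; c₁, …, c_u, i)`: the residue class of `μ(p; c₁, …, c_u, i)` modulo
`Δ(p; c₁, …, c_u, i)`, as a set of integers. -/
def mubar (c : List (Fin n)) (i : Fin n) : Set ℤ :=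
  {m | m ≡ p.mu c i [ZMOD p.delta c i]}

end Nanophrase

/-! ### Convergence of the coefficients -/

namespace NCSeries

variable {n : ℕ}

theorem mul_nil (f g : NCSeries n) : mul f g [] = f [] * g [] := by simp [mul]

theorem mul_cons (f g : NCSeries n) (a : Fin n) (c : List (Fin n)) :
    mul f g (a :: c) = f [] * g (a :: c) + mul (fun d => f (a :: d)) g c := by
  simp only [mul, List.length_cons]
  rw [Finset.sum_range_succ', add_comm]
  simp

theorem add_mul (f f' g : NCSeries n) : mul (f + f') g = mul f g + mul f' g := by
  funext c
  simp [mul, _root_.add_mul, Finset.sum_add_distrib]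

theorem mul_add (f g g' : NCSeries n) : mul f (g + g') = mul f g + mul f g' := by
  funext c
  simp [mul, _root_.mul_add, Finset.sum_add_distrib]

theorem smul_mul (a : ℤ) (f g : NCSeries n) : mul (fun d => a * f d) g = fun d => a * mul f g d := by
  funext c
  simp [mul, Finset.mul_sum, mul_assoc]

theorem zero_mul (g : NCSeries n) : mul (fun _ => 0) g = fun _ => 0 := by
  funext c
  simp [mul]

theorem one_mul (f : NCSeries n) : mul one f = f := by
  funext c
  cases c with
  | nil => simp [mul_nil, one]
  | cons a c =>
    have h : (fun d => one (a :: d) : NCSeries n) = fun _ => 0 := by funext d; simp [one]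
    rw [mul_cons, h, zero_mul]
    simp [one]

theorem mul_one (f : NCSeries n) : mul f one = f := by
  funext c
  induction c generalizing f with
  | nil => simp [mul_nil, one]
  | cons a c ih => rw [mul_cons, ih]; simp [one]

theorem mul_assoc (f g h : NCSeries n) : mul (mul f g) h = mul f (mul g h) := by
  funext c
  induction c generalizing f with
  | nil => simp [mul_nil, _root_.mul_assoc]
  | cons a c ih =>
    have e : (fun d => mul f g (a :: d) : NCSeries n) =
        (fun d => f [] * g (a :: d)) + mul (fun d => f (a :: d)) g := by
      funext d; simp [mul_cons]
    rw [mul_cons, e, add_mul, mul_cons, mul_cons g, Pi.add_apply, ih, mul_nil,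
      smul_mul (f []) (fun d => g (a :: d)) h]
    ring

theorem phi_append (w w' : SignedWord (Fin n)) : phi (w ++ w') = mul (phi w) (phi w') := by
  induction w with
  | nil => simp [phi, one_mul]
  | cons a w ih => simp [phi, ih, mul_assoc]

theorem phiLetter_nil (a : Fin n × Bool) : phiLetter a [] = 1 := by
  simp [phiLetter]

theorem phiLetter_inv_mul (a : Fin n × Bool) :
    mul (phiLetter (a.1, !a.2)) (phiLetter a) = one := by
  obtain ⟨h, b⟩ := a
  have key : ∀ a : Fin n, ∀ b : Bool, (fun d => phiLetter (h, b) (a :: d) : NCSeries n) =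
      if a = h then (if b then one else fun d => (-1) * phiLetter (h, false) d)
      else fun _ => 0 := by
    intro a b
    funext d
    by_cases ha : a = h
    · cases b <;> simp [phiLetter, one, ha, List.replicate_succ, pow_succ]
    · cases b <;> simp [phiLetter, ha, List.replicate_succ]
  funext c
  induction c with
  | nil => simp [mul_nil, phiLetter_nil, one]
  | cons a c ih =>
    rw [mul_cons, key, phiLetter_nil]
    have k2 := congrFun (key a b) c
    dsimp only at k2 ih ⊢
    rw [k2]
    by_cases ha : a = h
    · cases b
      · simp [ha, one_mul, one]
      · simp only [Bool.not_true] at ih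
        have h2 : mul (fun d => (-1) * phiLetter (h, false) d) (phiLetter (h, true)) c =
            (-1) * one c := by rw [smul_mul]; dsimp only; rw [ih]
        simp only [ha, if_true, Bool.not_true, Bool.false_eq_true, if_false]
        rw [h2]
        by_cases hc : c = [] <;> simp [one, hc]
    · simp [ha, zero_mul, one]

theorem phi_inv_mul (w : SignedWord (Fin n)) : mul (phi w.inv) (phi w) = one := by
  induction w with
  | nil => simp [SignedWord.inv, phi, one_mul]
  | cons a w ih =>
    have e : SignedWord.inv (a :: w) = SignedWord.inv w ++ [(a.1, !a.2)] := by
      simp [SignedWord.inv]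
    rw [e, phi_append]
    simp only [phi, mul_one]
    rw [mul_assoc, ← mul_assoc _ (phiLetter a), phiLetter_inv_mul, one_mul, ih]

/-- Two series agree in all degrees less than `d`. -/
def AgreeBelow (d : ℕ) (f g : NCSeries n) : Prop :=
  ∀ c : List (Fin n), c.length < d → f c = g c

theorem AgreeBelow.mul {d : ℕ} {f f' g g' : NCSeries n} (hf : AgreeBelow d f f')
    (hg : AgreeBelow d g g') : AgreeBelow d (mul f g) (mul f' g') := by
  intro c hc
  refine Finset.sum_congr rfl fun j _ => ?_
  rw [hf _ (by simp; omega), hg _ (by simp; omega)]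

/-- If `N` has no constant term, `Y N X` is determined below degree `d + 1` by `X`, `Y` below
degree `d`. -/
theorem AgreeBelow.conj {d : ℕ} {X X' Y Y' N : NCSeries n} (hN : N [] = 0)
    (hX : AgreeBelow d X X') (hY : AgreeBelow d Y Y') :
    AgreeBelow (d + 1) (NCSeries.mul Y (NCSeries.mul N X))
      (NCSeries.mul Y' (NCSeries.mul N X')) := by
  have h1 : AgreeBelow (d + 1) (NCSeries.mul N X) (NCSeries.mul N X') := by
    intro c hc
    refine Finset.sum_congr rfl fun j _ => ?_
    rcases Nat.eq_zero_or_pos j with rfl | hj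
    · simp [hN]
    · rcases Nat.eq_zero_or_pos c.length with h0 | h0
      · have : c = [] := List.length_eq_zero_iff.1 h0
        subst this; simp [hN]
      · rw [hX _ (by simp; omega)]
  intro c hc
  refine Finset.sum_congr rfl fun j hj => ?_
  have hj' : j ≤ c.length := by simpa [Nat.lt_succ_iff] using hj
  rw [h1 _ (by simp; omega)]
  rcases Nat.lt_or_ge j c.length with h | h
  · rw [hY _ (by simp; omega)]
  · have : c.drop j = [] := List.drop_eq_nil_of_le h
    rw [this, mul_nil, hN]
    simp

end NCSeries

namespace Nanophrase

open NCSeries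

variable {n : ℕ} (p : Nanophrase.{u} AlphaV n)

theorem etaWord_inv (w : SignedWord p.Letter) : p.etaWord w.inv = (p.etaWord w).inv := by
  simp [etaWord, SignedWord.inv]

theorem etaWord_append (w w' : SignedWord p.Letter) :
    p.etaWord (w ++ w') = p.etaWord w ++ p.etaWord w' := by
  simp [etaWord]

theorem inv_append {L : Type*} (w w' : SignedWord L) :
    SignedWord.inv (w ++ w') = SignedWord.inv w' ++ SignedWord.inv w := by
  simp [SignedWord.inv]

theorem inv_inv {L : Type*} (w : SignedWord L) : w.inv.inv = w := by
  simp [SignedWord.inv, Function.comp_def]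

theorem rho_cons (q : ℕ) (a : p.Letter × Bool) (w : SignedWord p.Letter) :
    p.rho q (a :: w) = p.rho q [a] ++ p.rho q w := by
  match q with
  | 0 | 1 | 2 => simp [rho]
  | q + 3 => simp [rho]

theorem rho_nil (q : ℕ) : p.rho q [] = [] := by
  match q with
  | 0 | 1 | 2 => simp [rho]
  | q + 3 => simp [rho]

theorem rho_append (q : ℕ) (w w' : SignedWord p.Letter) :
    p.rho q (w ++ w') = p.rho q w ++ p.rho q w' := by
  induction w with
  | nil => simp [rho_nil]
  | cons a w ih => rw [List.cons_append, rho_cons, ih, rho_cons p q a w, List.append_assoc]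

theorem rho_inv (q : ℕ) (w : SignedWord p.Letter) : p.rho q w.inv = (p.rho q w).inv := by
  induction q using Nat.strong_induction_on generalizing w with
  | _ q ihq =>
    match q with
    | 0 | 1 | 2 => simp [rho]
    | q + 3 =>
      induction w with
      | nil => simp [SignedWord.inv, rho_nil]
      | cons a w ih =>
        have e : SignedWord.inv (a :: w) = SignedWord.inv w ++ [(a.1, !a.2)] := by
          simp [SignedWord.inv]
        rw [e, rho_append, ih, rho_cons p _ a w, inv_append]
        congr 1
        simp only [rho, List.flatMap_cons, List.flatMap_nil, List.append_nil]
        rw [inv_append, inv_append, ihq (q + 2) (by omega), inv_inv, List.append_assoc]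
        simp [SignedWord.inv]

/-- Below degree `q`, the expansions of `ρ^q` and `ρ^{q+1}` agree. -/
theorem agreeBelow_rho (q : ℕ) (hq : 2 ≤ q) (w : SignedWord p.Letter) :
    AgreeBelow q (phi (p.etaWord (p.rho (q + 1) w))) (phi (p.etaWord (p.rho q w))) := by
  -- the expansion of one signed letter
  have key : ∀ r, 2 ≤ r → ∀ a : p.Letter × Bool, phi (p.etaWord (p.rho (r + 1) [a])) =
      NCSeries.one + NCSeries.mul (phi (p.etaWord (p.rho r (p.before a.1))).inv)
        (NCSeries.mul (phiLetter (p.eta a.1, a.2) - NCSeries.one)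
          (phi (p.etaWord (p.rho r (p.before a.1))))) := by
    intro r hr a
    obtain ⟨r, rfl⟩ := Nat.exists_eq_add_of_le' hr
    have e : p.rho (r + 2 + 1) [a] =
        p.rho (r + 2) (p.before a.1).inv ++ ([a] ++ p.rho (r + 2) (p.before a.1)) := by
      simp [rho]
    rw [e, etaWord_append, etaWord_append, rho_inv, etaWord_inv, phi_append, phi_append]
    set X := p.etaWord (p.rho (r + 2) (p.before a.1))
    have e2 : phi (p.etaWord [a]) =
        NCSeries.one + (phiLetter (p.eta a.1, a.2) - NCSeries.one) := by
      simp [etaWord, phi, NCSeries.mul_one]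
    rw [e2, NCSeries.add_mul, NCSeries.one_mul, NCSeries.mul_add, phi_inv_mul]
  induction q, hq using Nat.le_induction generalizing w with
  | base =>
    induction w with
    | nil => simp only [rho_nil]; exact fun _ _ => rfl
    | cons a w ih =>
      rw [rho_cons, rho_cons p 2, etaWord_append, etaWord_append, phi_append, phi_append]
      refine AgreeBelow.mul ?_ ih
      rw [key 2 le_rfl]
      have e2 : phi (p.etaWord (p.rho 2 [a])) = NCSeries.one + NCSeries.mul NCSeries.one
          (NCSeries.mul (phiLetter (p.eta a.1, a.2) - NCSeries.one) NCSeries.one) := by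
        simp [rho, etaWord, phi, NCSeries.mul_one, NCSeries.one_mul]
      rw [e2]
      have h0 : ∀ w : SignedWord (Fin n), AgreeBelow 1 (phi w) NCSeries.one := by
        intro w c hc
        have : c = [] := List.length_eq_zero_iff.1 (by omega)
        subst this
        induction w with
        | nil => rfl
        | cons a w ih => simp [phi, NCSeries.mul_nil, phiLetter_nil, ih, NCSeries.one]
      have h := AgreeBelow.conj (N := phiLetter (p.eta a.1, a.2) - NCSeries.one)
        (by simp [phiLetter_nil, NCSeries.one])
        (h0 (p.etaWord (p.rho 2 (p.before a.1)))) (h0 (p.etaWord (p.rho 2 (p.before a.1))).inv)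
      intro c hc
      simp only [Pi.add_apply]
      rw [h c hc]
  | succ q hq ihq =>
    induction w with
    | nil => simp only [rho_nil]; exact fun _ _ => rfl
    | cons a w ih =>
      rw [rho_cons, rho_cons p (q + 1), etaWord_append, etaWord_append, phi_append, phi_append]
      refine AgreeBelow.mul ?_ ih
      rw [key (q + 1) (by omega), key q hq]
      have hX := ihq (p.before a.1)
      have hY := ihq (p.before a.1).inv
      rw [rho_inv, rho_inv, etaWord_inv, etaWord_inv] at hY
      have h := AgreeBelow.conj (N := phiLetter (p.eta a.1, a.2) - NCSeries.one)
        (by simp [phiLetter_nil, NCSeries.one]) hX hY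
      intro c hc
      simp only [Pi.add_apply]
      rw [h c hc]

/-- The coefficients converge (they are eventually constant), so `mu` is their limit. -/
theorem expansion_eq_mu (c : List (Fin n)) (i : Fin n) (q : ℕ) (hq : 2 ≤ q)
    (hc : c.length < q) : p.expansion q i c = p.mu c i := by
  have hconst : ∀ r, q ≤ r → p.expansion r i c = p.expansion q i c := by
    intro r hr
    induction r, hr using Nat.le_induction with
    | base => rfl
    | succ r hr ih =>
      rw [← ih]
      exact p.agreeBelow_rho r (by omega) _ c (by omega)
  have ht : Filter.Tendsto (fun r => p.expansion r i c) Filter.atTop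
      (nhds (p.expansion q i c)) :=
    tendsto_const_nhds.congr' (Filter.eventually_atTop.2 ⟨q, fun r hr => (hconst r hr).symm⟩)
  exact ht.limUnder_eq.symm

end Nanophrase

/-! ### Evaluation of signed words in a group -/

/-! The invariants are read off from matrices. For a list `c` without repetition, index rows and
columns by the gaps of `c`, and let κ_k have a 1 at (a, a+1) whenever the entry of `c` between these
two gaps is k. The "meridians" 1 + κ_k lie in the nilpotent group of unitriangular matrices and
commute there with all their conjugates, because k occurs at most once in `c`; this is the defining
relation of Milnor's reduced free group. By `eval_meridian_apply`, the entry (a, b) of a word in the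
meridians is the coefficient, in its expansion φ, of the part of `c` between the gaps a and b. Since
the indices of the theorem are distinct, such square-free coefficients are all that is needed.

The maps ρ^q approximate a fixed point. Such a fixed point is a coloring: each letter joining two
components has as value the conjugate x⁻¹ g_k x of the meridian of the component k of its occurrence
of sign zero (its "over" occurrence), where x is the product along that component up to this
occurrence. In a nilpotent group colorings exist (`exists_isColoring_approxValue`) and give unique
contributions along the components (`IsColoring.val_eq`). So the product along a component under any
coloring, its "longitude", has numbers μ as entries (`longitude_apply`), and it suffices to compare
colorings.

All moves except the shift carry a coloring to a coloring and preserve the longitude of each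
component k modulo the normal closure of g_k (`TransfersTo`). This precision is enough to continue,
as x⁻¹ g_k x depends only on that class of x. Since i is not in `c`, the meridian of i is 1, so the
longitude of i, and with it μ, is preserved exactly.

A shift on the component k conjugates its meridian and its longitude. If the moved occurrence is an
over occurrence, the coloring survives only if meridian and longitude of k commute. Modulo a number
N that divides all lower μ they do (`commute_longitude`); this is where cyclic permutations enter.
Modulo N the expansion along `c` also has only its constant and top terms, and the top coefficient
does not notice conjugated meridians (`eval_conj_meridian_apply`). Hence `MuCongruent` holds for
every move; an induction on length (`MuCongruent.dvd`) then shows that the numbers Δ agree as well.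
-/

namespace SignedWord

/-- The product in a group of the values of the letters of a signed word. -/
def eval {L G : Type*} [Group G] (m : L → G) (w : SignedWord L) : G :=
  (w.map fun a => if a.2 then m a.1 else (m a.1)⁻¹).prod

variable {L L' G H : Type*} [Group G] [Group H]

@[simp] theorem eval_nil (m : L → G) : eval m [] = 1 := rfl

theorem eval_cons (m : L → G) (a : L × Bool) (w : SignedWord L) :
    eval m (a :: w) = (if a.2 then m a.1 else (m a.1)⁻¹) * eval m w := by
  simp [eval]

theorem eval_append (m : L → G) (w w' : SignedWord L) :
    eval m (w ++ w') = eval m w * eval m w' := by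
  simp [eval]

theorem eval_inv (m : L → G) (w : SignedWord L) : eval m w.inv = (eval m w)⁻¹ := by
  induction w with
  | nil => simp [SignedWord.inv]
  | cons a w ih =>
    have e : SignedWord.inv (a :: w) = SignedWord.inv w ++ [(a.1, !a.2)] := by
      simp [SignedWord.inv]
    rw [e, eval_append, ih, eval_cons m a, mul_inv_rev, eval_cons]
    obtain ⟨A, b⟩ := a
    cases b <;> simp

theorem map_eval (f : G →* H) (m : L → G) (w : SignedWord L) :
    f (eval m w) = eval (fun A => f (m A)) w := by
  induction w with
  | nil => simp
  | cons a w ih =>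
    rw [eval_cons, eval_cons, map_mul, ih]
    split_ifs <;> simp

theorem eval_congr {m m' : L → G} {w : SignedWord L} (h : ∀ a ∈ w, m a.1 = m' a.1) :
    eval m w = eval m' w := by
  unfold eval
  congr 1
  refine List.map_congr_left fun a ha => ?_
  rw [h a ha]

end SignedWord

/-! ### The expansion in square-free variables -/

namespace NCSeries

variable {n : ℕ}

theorem mul_phiLetter_of_notMem (h : Fin n) (b : Bool) (f : NCSeries n) (d : List (Fin n))
    (hd : h ∉ d) : mul (phiLetter (h, b)) f d = f d := by
  cases d with
  | nil => simp [mul_nil, phiLetter_nil]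
  | cons a d =>
    have ha : ¬ a = h := by rintro rfl; simp at hd
    have e : (fun d => phiLetter (h, b) (a :: d) : NCSeries n) = fun _ => 0 := by
      funext d
      cases b <;> simp [phiLetter, ha, List.replicate_succ]
    rw [mul_cons, e, zero_mul, phiLetter_nil]
    simp

/-- The coefficient of a square-free monomial after multiplication by one letter. -/
theorem phi_cons_apply (h : Fin n) (b : Bool) (w : SignedWord (Fin n)) (a : Fin n)
    (d : List (Fin n)) (hd : (a :: d).Nodup) :
    phi ((h, b) :: w) (a :: d) =
      phi w (a :: d) + if a = h then (if b then phi w d else -phi w d) else 0 := by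
  have e : (fun d => phiLetter (h, b) (a :: d) : NCSeries n) =
      if a = h then (if b then one else fun d => (-1) * phiLetter (h, false) d)
      else fun _ => 0 := by
    funext d
    by_cases ha : a = h
    · cases b <;> simp [phiLetter, one, ha, List.replicate_succ, pow_succ]
    · cases b <;> simp [phiLetter, ha, List.replicate_succ]
  rw [phi, mul_cons, e, phiLetter_nil, _root_.one_mul]
  congr 1
  by_cases ha : a = h
  · subst ha
    cases b
    · simp only [if_true, Bool.false_eq_true, if_false]
      rw [smul_mul]
      beta_reduce
      rw [mul_phiLetter_of_notMem _ _ _ _ (List.nodup_cons.1 hd).1]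
      simp
    · simp [one_mul]
  · simp [ha, zero_mul]

theorem phi_nil_apply (w : SignedWord (Fin n)) : phi w [] = 1 := by
  induction w with
  | nil => rfl
  | cons a w ih => simp [phi, mul_nil, phiLetter_nil, ih]

/-- The evaluation of a word at units `1 + T k`, when all the products of the `T k` vanish except
those along sublists of a list without repetition. -/
theorem eval_eq_sum {S : Type*} [Ring S] (c : List (Fin n)) (hc : c.Nodup) (T : Fin n → S)
    (h : Fin n → Sˣ) (h1 : ∀ k, (h k : S) = 1 + T k) (h2 : ∀ k, ((h k)⁻¹ : Sˣ) = 1 - T k)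
    (hT : ∀ d : List (Fin n), ¬ d.Sublist c → (d.map T).prod = 0) (w : SignedWord (Fin n)) :
    ((SignedWord.eval h w : Sˣ) : S) =
      ∑ d ∈ c.sublists.toFinset, (phi w d : S) * (d.map T).prod := by
  induction w with
  | nil =>
    rw [Finset.sum_eq_single []]
    · simp [phi, one]
    · intro d _ hd
      simp [phi, one, hd]
    · simp
  | cons a w ih =>
    obtain ⟨a, b⟩ := a
    -- `F` collects the terms that a new first letter `a` creates: monomials that start with `a`.
    set F : List (Fin n) → S := fun d => match d with
      | [] => 0
      | e :: d => if e = a then (phi w d : S) * (T e * (d.map T).prod) else 0 with hF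
    have hsplit : ∀ d ∈ c.sublists.toFinset, (phi ((a, b) :: w) d : S) * (d.map T).prod =
        (phi w d : S) * (d.map T).prod + if b then F d else -F d := by
      intro d hd
      have hd' : d.Nodup := by
        simp only [List.mem_toFinset, List.mem_sublists] at hd
        exact hd.nodup hc
      match d, hd' with
      | [], _ => simp [phi_nil_apply, hF]
      | e :: d, hd' =>
        rw [phi_cons_apply _ _ _ _ _ hd']
        by_cases he : e = a
        · cases b <;> simp [he, hF, _root_.add_mul]
        · simp [he, hF]
    -- Prepending `a` may lead out of the sublists of `c`, but there the product of the `T`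
    -- vanishes. Both sums are therefore compared over the union of the sublists and the lists `a ::
    -- d`.
    have hsum : ∑ d ∈ c.sublists.toFinset, F d =
        T a * ∑ d ∈ c.sublists.toFinset, (phi w d : S) * (d.map T).prod := by
      have e1 : ∑ d ∈ c.sublists.toFinset, F d =
          ∑ d ∈ c.sublists.toFinset ∪ c.sublists.toFinset.image (List.cons a), F d := by
        refine Finset.sum_subset Finset.subset_union_left fun d _ hd => ?_
        simp only [List.mem_toFinset, List.mem_sublists] at hd
        have := hT d hd
        match d, this with
        | [], _ => rfl
        | e :: d, this =>
          simp only [hF]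
          simp only [List.map_cons, List.prod_cons] at this
          rw [this]; simp
      have e2 : ∑ d ∈ c.sublists.toFinset.image (List.cons a), F d =
          ∑ d ∈ c.sublists.toFinset ∪ c.sublists.toFinset.image (List.cons a), F d := by
        refine Finset.sum_subset Finset.subset_union_right fun d hd hd' => ?_
        match d with
        | [] => rfl
        | e :: d =>
          simp only [hF]
          split_ifs with he
          · subst he
            exfalso
            simp only [Finset.mem_union, List.mem_toFinset, List.mem_sublists,
              Finset.mem_image] at hd hd'
            rcases hd with hd | hd
            · exact hd' ⟨d, (List.sublist_cons_self _ _).trans hd, rfl⟩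
            · exact hd' hd
          · rfl
      rw [e1, ← e2, Finset.sum_image (by intro x _ y _ hxy; simpa using hxy), Finset.mul_sum]
      refine Finset.sum_congr rfl fun d _ => ?_
      simp only [hF, if_true]
      rw [← _root_.mul_assoc, ← _root_.mul_assoc, (Int.cast_commute _ _).eq]
    rw [Finset.sum_congr rfl hsplit, Finset.sum_add_distrib, SignedWord.eval_cons, Units.val_mul,
      ih]
    cases b
    · simp [h2, hsum, _root_.sub_mul, ← sub_eq_add_neg]
    · simp [h1, hsum, _root_.add_mul]

end NCSeries

/-! ### Matrices supported on intervals of a list -/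

section Supported

variable {n : ℕ} (c : List (Fin n)) {R : Type*} [CommRing R]

/-- Square matrices with rows and columns indexed by the gaps of the list `c`. -/
abbrev GapMatrix (R : Type*) := Matrix (Fin (c.length + 1)) (Fin (c.length + 1)) R

/-- The part of `c` between two gaps. -/
def gapInterval (a b : ℕ) : List (Fin n) := (c.take b).drop a

theorem gapInterval_append {a m b : ℕ} (h1 : a ≤ m) (h2 : m ≤ b) :
    gapInterval c a m ++ gapInterval c m b = gapInterval c a b := by
  obtain ⟨i, rfl⟩ := Nat.exists_eq_add_of_le h1
  obtain ⟨j, rfl⟩ := Nat.exists_eq_add_of_le h2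
  simp only [gapInterval, List.drop_take, Nat.add_sub_cancel_left]
  rw [show a + i + j - a = i + j by omega, List.take_add, List.drop_drop]

theorem length_gapInterval {a b : ℕ} (h : b ≤ c.length) :
    (gapInterval c a b).length = b - a := by
  simp [gapInterval, h]

theorem gapInterval_sublist (a b : ℕ) : (gapInterval c a b).Sublist c :=
  (List.drop_sublist _ _).trans (List.take_sublist _ _)

variable {c}

/-- The nonzero entries of `Y` are on or above the diagonal, at places where the part of the list
between the two gaps satisfies `P`. -/
def Supported (P : List (Fin n) → Prop) (Y : GapMatrix c R) : Prop :=
  ∀ a b, Y a b ≠ 0 → a ≤ b ∧ P (gapInterval c a b)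

/-- Matrix multiplication concatenates adjacent intervals of `c`. With this, the vanishing of a
product becomes a statement that no sublist of `c` has a certain form. -/
theorem Supported.mul {P Q W : List (Fin n) → Prop} (h : ∀ x y, P x → Q y → W (x ++ y))
    {Y Z : GapMatrix c R} (hY : Supported P Y) (hZ : Supported Q Z) : Supported W (Y * Z) := by
  intro a b hab
  rw [Matrix.mul_apply] at hab
  obtain ⟨m, _, hm⟩ := Finset.exists_ne_zero_of_sum_ne_zero hab
  obtain ⟨h1, h2⟩ := hY a m (left_ne_zero_of_mul hm)
  obtain ⟨h3, h4⟩ := hZ m b (right_ne_zero_of_mul hm)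
  refine ⟨h1.trans h3, ?_⟩
  rw [← gapInterval_append c (Fin.le_def.1 h1) (Fin.le_def.1 h3)]
  exact h _ _ h2 h4

theorem Supported.mono {P Q : List (Fin n) → Prop} (h : ∀ x, P x → Q x)
    {Y : GapMatrix c R} (hY : Supported P Y) : Supported Q Y :=
  fun a b hab => ⟨(hY a b hab).1, h _ (hY a b hab).2⟩

theorem Supported.add {P : List (Fin n) → Prop} {Y Z : GapMatrix c R} (hY : Supported P Y)
    (hZ : Supported P Z) : Supported P (Y + Z) := by
  intro a b hab
  by_cases h : Y a b = 0
  · exact hZ a b (by simpa [h] using hab)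
  · exact hY a b h

theorem Supported.neg {P : List (Fin n) → Prop} {Y : GapMatrix c R} (hY : Supported P Y) :
    Supported P (-Y) :=
  fun a b hab => hY a b (by simpa using hab)

theorem Supported.sub {P : List (Fin n) → Prop} {Y Z : GapMatrix c R} (hY : Supported P Y)
    (hZ : Supported P Z) : Supported P (Y - Z) := by
  rw [sub_eq_add_neg]; exact hY.add hZ.neg

theorem supported_one {P : List (Fin n) → Prop} (h : P []) :
    Supported P (1 : GapMatrix c R) := by
  intro a b hab
  have : a = b := by
    by_contra hne
    exact hab (Matrix.one_apply_ne hne)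
  subst this
  refine ⟨le_rfl, ?_⟩
  have : gapInterval c a a = [] := List.drop_eq_nil_of_le (by simp)
  rwa [this]

theorem supported_zero {P : List (Fin n) → Prop} : Supported P (0 : GapMatrix c R) :=
  fun _ _ hab => absurd rfl hab

theorem Supported.eq_zero {P : List (Fin n) → Prop} {Y : GapMatrix c R} (hY : Supported P Y)
    (h : ∀ d, d.Sublist c → ¬ P d) : Y = 0 := by
  ext a b
  by_contra hne
  exact h _ (gapInterval_sublist c _ _) (hY a b hne).2

/-- The matrices that vanish below the `d`-th superdiagonal. -/
abbrev DegreeGE (d : ℕ) : GapMatrix c R → Prop := Supported fun x => d ≤ x.length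

theorem DegreeGE.mul {d e : ℕ} {Y Z : GapMatrix c R} (hY : DegreeGE d Y) (hZ : DegreeGE e Z) :
    DegreeGE (d + e) (Y * Z) :=
  Supported.mul (fun x y hx hy => by simp; omega) hY hZ

theorem DegreeGE.eq_zero {d : ℕ} (hd : c.length < d) {Y : GapMatrix c R} (hY : DegreeGE d Y) :
    Y = 0 :=
  Supported.eq_zero hY fun x hx h => by have := hx.length_le; omega

/-- The matrix of the variable `κ_k`. -/
def kappa (c : List (Fin n)) (R : Type*) [CommRing R] (k : Fin n) : GapMatrix c R :=
  fun a b => if (a : ℕ) + 1 = b ∧ (c)[(a : ℕ)]? = some k then 1 else 0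

theorem gapInterval_succ {a b : ℕ} (h : a < b) {k : Fin n} (hk : (c)[a]? = some k) :
    gapInterval c a b = k :: gapInterval c (a + 1) b := by
  obtain ⟨ha, hk⟩ := List.getElem?_eq_some_iff.1 hk
  have hl : a < (c.take b).length := by simp; omega
  rw [gapInterval, List.drop_eq_getElem_cons hl]
  simp [gapInterval, hk]

/-- Each factor κ_k moves one gap to the right across an entry k of `c`, so from `a` there is at
most one path that reads `d`. -/
theorem prod_kappa (d : List (Fin n)) (a b : Fin (c.length + 1)) :
    (d.map (kappa c R)).prod a b = if a ≤ b ∧ d = gapInterval c a b then 1 else 0 := by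
  induction d generalizing a with
  | nil =>
    rw [List.map_nil, List.prod_nil, Matrix.one_apply]
    refine if_congr ⟨?_, ?_⟩ rfl rfl
    · rintro rfl
      exact ⟨le_rfl, (List.drop_eq_nil_of_le (by simp)).symm⟩
    · rintro ⟨h, h2⟩
      have := length_gapInterval c (a := a) (b := b) (by omega)
      rw [← h2] at this
      simp at this
      ext; have := Fin.le_def.1 h; omega
  | cons k d ih =>
    rw [List.map_cons, List.prod_cons, Matrix.mul_apply]
    by_cases hk : (c)[(a : ℕ)]? = some k
    · have ha := (List.getElem?_eq_some_iff.1 hk).1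
      rw [Finset.sum_eq_single (⟨a + 1, by omega⟩ : Fin (c.length + 1))]
      · rw [ih]
        simp only [kappa, hk, and_self, if_true, one_mul, Fin.le_def]
        refine if_congr ⟨?_, ?_⟩ rfl rfl
        · rintro ⟨h, rfl⟩
          exact ⟨by omega, (gapInterval_succ (by omega) hk).symm⟩
        · rintro ⟨h, h2⟩
          have hab : (a : ℕ) < b := by
            by_contra hge
            have := length_gapInterval c (a := a) (b := b) (by omega)
            rw [← h2] at this
            simp at this
            omega
          rw [gapInterval_succ hab hk] at h2
          exact ⟨hab, by simpa using h2⟩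
      · intro j _ hj
        have : ¬ ((a : ℕ) + 1 = j) := fun h => hj (Fin.ext h.symm)
        simp [kappa, this]
      · simp
    · rw [if_neg, Finset.sum_eq_zero]
      · intro j _
        simp [kappa, hk]
      · rintro ⟨h, h2⟩
        have hl := length_gapInterval c (a := a) (b := b) (by omega)
        rw [← h2] at hl
        simp only [List.length_cons] at hl
        have ha : (a : ℕ) < c.length := by omega
        have := gapInterval_succ (c := c) (a := a) (b := b) (by omega)
          (List.getElem?_eq_getElem ha)
        rw [← h2] at this
        simp only [List.cons.injEq] at this
        exact hk (by rw [List.getElem?_eq_getElem ha, this.1])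

theorem supported_kappa (k : Fin n) : Supported (fun x => [k] = x) (kappa c R k) := by
  intro a b hab
  have := prod_kappa (R := R) [k] a b
  simp only [List.map_cons, List.map_nil, List.prod_cons, List.prod_nil, mul_one] at this
  rw [this] at hab
  by_contra h
  exact hab (if_neg h)

end Supported

/-! ### Unitriangular matrices -/

section Unitriangular

variable {n : ℕ} (c : List (Fin n)) (R : Type*) [CommRing R]

/-- The invertible matrices that differ from `1` only on and above the `d`-th superdiagonal. -/
def unitriangular (d : ℕ) : Subgroup (GapMatrix c R)ˣ where
  carrier := {x | DegreeGE d ((x : GapMatrix c R) - 1) ∧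
    DegreeGE d (((x⁻¹ : (GapMatrix c R)ˣ) : GapMatrix c R) - 1)}
  one_mem' := by simp [supported_zero]
  inv_mem' := by rintro x ⟨h1, h2⟩; exact ⟨h2, by simpa using h1⟩
  mul_mem' := by
    have key : ∀ X Y : GapMatrix c R, DegreeGE d (X - 1) → DegreeGE d (Y - 1) →
        DegreeGE d (X * Y - 1) := by
      intro X Y hX hY
      have e : X * Y - 1 = (X - 1) * (Y - 1) + (X - 1) + (Y - 1) := by noncomm_ring
      rw [e]
      refine Supported.add (Supported.add ?_ hX) hY
      exact Supported.mul (fun x y hx _ => by simp; omega) hX hY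
    rintro x y ⟨h1, h2⟩ ⟨h3, h4⟩
    refine ⟨by rw [Units.val_mul]; exact key _ _ h1 h3, ?_⟩
    rw [mul_inv_rev, Units.val_mul]
    exact key _ _ h4 h2

variable {c R}

theorem degreeGE_zero_of_mem {d : ℕ} {x : (GapMatrix c R)ˣ} (hx : x ∈ unitriangular c R d) :
    DegreeGE 0 (x : GapMatrix c R) := by
  have h := (Supported.mono (Q := fun x => 0 ≤ x.length) (fun _ _ => Nat.zero_le _) hx.1).add
    (supported_one (c := c) (R := R) (P := fun x => 0 ≤ x.length) (Nat.zero_le _))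
  rwa [sub_add_cancel] at h

/-- From the identity xyx⁻¹y⁻¹ - 1 = ((x-1)(y-1) - (y-1)(x-1)) x⁻¹y⁻¹, in which the last factor has
degree at least 0. The inverse of a commutator is the commutator with x and y exchanged. -/
theorem commutator_mem_unitriangular {d e : ℕ} {x y : (GapMatrix c R)ˣ}
    (hx : x ∈ unitriangular c R d) (hy : y ∈ unitriangular c R e) :
    x * y * x⁻¹ * y⁻¹ ∈ unitriangular c R (d + e) := by
  have key : ∀ {d e : ℕ} {x y : (GapMatrix c R)ˣ}, x ∈ unitriangular c R d →
      y ∈ unitriangular c R e →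
      DegreeGE (d + e) (((x * y * x⁻¹ * y⁻¹ : (GapMatrix c R)ˣ) : GapMatrix c R) - 1) := by
    intro d e x y hx hy
    have e1 : ((x * y * x⁻¹ * y⁻¹ : (GapMatrix c R)ˣ) : GapMatrix c R) - 1 =
        ((x - 1 : GapMatrix c R) * (y - 1) - (y - 1) * (x - 1)) *
          ((x⁻¹ * y⁻¹ : (GapMatrix c R)ˣ) : GapMatrix c R) := by
      have e2 : ((x - 1 : GapMatrix c R) * (y - 1) - (y - 1) * (x - 1)) =
          ((x * y : (GapMatrix c R)ˣ) : GapMatrix c R) - ((y * x : (GapMatrix c R)ˣ)) := by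
        push_cast; noncomm_ring
      rw [e2, sub_mul, ← Units.val_mul, ← Units.val_mul]
      congr 2
      · group
      · rw [eq_comm, Units.val_eq_one]; group
    rw [e1]
    have h1 := (DegreeGE.mul hx.1 hy.1).sub (Nat.add_comm e d ▸ DegreeGE.mul hy.1 hx.1)
    have h2 := DegreeGE.mul (degreeGE_zero_of_mem (inv_mem hx)) (degreeGE_zero_of_mem (inv_mem hy))
    rw [← Units.val_mul] at h2
    have h3 := DegreeGE.mul (d := d + e) h1 h2
    simpa using h3
  refine ⟨key hx hy, ?_⟩
  have : (x * y * x⁻¹ * y⁻¹)⁻¹ = y * x * y⁻¹ * x⁻¹ := by group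
  rw [this, add_comm]
  exact key hy hx

/-- The superdiagonal filtration, shifted by one, is a descending central series. It is trivial from
degree `c.length + 1` on, as no interval of `c` is that long. -/
instance : Group.IsNilpotent (unitriangular c R 1) := by
  rw [Subgroup.nilpotent_iff_finite_descending_central_series]
  refine ⟨c.length, fun d => (unitriangular c R (d + 1)).subgroupOf (unitriangular c R 1),
    ⟨by simp, ?_⟩, ?_⟩
  · intro x d hx y
    exact commutator_mem_unitriangular (d := d + 1) (e := 1) hx y.2
  · rw [eq_bot_iff]
    intro x hx
    rw [Subgroup.mem_subgroupOf] at hx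
    have := DegreeGE.eq_zero (Nat.lt_succ_self _) hx.1
    rw [Subgroup.mem_bot]
    exact Subtype.ext (Units.ext (sub_eq_zero.1 this))

theorem supported_nil_of_mem (x : unitriangular c R 1) :
    Supported (fun y => [].Sublist y) ((x : (GapMatrix c R)ˣ) : GapMatrix c R) :=
  (degreeGE_zero_of_mem x.2).mono fun _ _ => List.nil_sublist _

theorem kappa_mul_kappa (hc : c.Nodup) (k : Fin n) : kappa c R k * kappa c R k = 0 := by
  have h := Supported.mul (W := fun x => [k, k] = x) (by rintro _ _ rfl rfl; rfl)
    (supported_kappa (c := c) (R := R) k) (supported_kappa (c := c) (R := R) k)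
  refine h.eq_zero ?_
  rintro _ hd rfl
  have := hd.nodup hc
  simp at this

/-- The unitriangular matrix `1 + κ_k`, the value of `a_k`. -/
def meridian (R : Type*) [CommRing R] (hc : c.Nodup) (k : Fin n) : unitriangular c R 1 :=
  ⟨⟨1 + kappa c R k, 1 - kappa c R k, by
      have := kappa_mul_kappa (R := R) hc k
      noncomm_ring; simp [this], by
      have := kappa_mul_kappa (R := R) hc k
      noncomm_ring; simp [this]⟩, by
    have h : DegreeGE 1 (kappa c R k) := (supported_kappa k).mono (by rintro _ rfl; simp)
    refine ⟨?_, ?_⟩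
    · simpa using h
    · simpa [sub_sub_cancel_left] using Supported.neg h⟩

theorem coe_meridian (hc : c.Nodup) (k : Fin n) :
    ((meridian R hc k : (GapMatrix c R)ˣ) : GapMatrix c R) = 1 + kappa c R k := rfl

theorem coe_meridian_inv (hc : c.Nodup) (k : Fin n) :
    (((meridian R hc k : (GapMatrix c R)ˣ)⁻¹ : (GapMatrix c R)ˣ) : GapMatrix c R) =
      1 - kappa c R k := rfl

theorem meridian_eq_one (hc : c.Nodup) {k : Fin n} (hk : k ∉ c) : meridian R hc k = 1 := by
  refine Subtype.ext (Units.ext ?_)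
  have : kappa c R k = 0 := (supported_kappa k).eq_zero (by
    rintro _ hd rfl
    exact hk (hd.subset (by simp)))
  rw [coe_meridian, this]; simp

/-- The variable `κ_k` conjugated by `x`. -/
def conjKappa (x : unitriangular c R 1) (k : Fin n) : GapMatrix c R :=
  ((x⁻¹ : unitriangular c R 1) : (GapMatrix c R)ˣ) * kappa c R k * (x : (GapMatrix c R)ˣ)

theorem supported_conjKappa (x : unitriangular c R 1) (k : Fin n) :
    Supported (fun y => [k].Sublist y) (conjKappa x k) := by
  have h1 : Supported (fun y => [k].Sublist y) (kappa c R k) :=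
    (supported_kappa k).mono (by rintro _ rfl; simp)
  refine Supported.mul (fun y z hy _ => hy.trans (List.sublist_append_left _ _))
    (Supported.mul (fun y z _ hz => hz.trans (List.sublist_append_right _ _))
      (supported_nil_of_mem x⁻¹) h1) (supported_nil_of_mem x)

theorem coe_conj_meridian (hc : c.Nodup) (x : unitriangular c R 1) (k : Fin n) :
    ((x⁻¹ * meridian R hc k * x : unitriangular c R 1) : (GapMatrix c R)ˣ).val =
      1 + conjKappa x k := by
  simp only [Subgroup.coe_mul, Units.val_mul, coe_meridian, conjKappa, mul_add, mul_one, add_mul]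
  congr 1
  rw [← Units.val_mul, ← Subgroup.coe_mul]
  simp

theorem coe_conj_meridian_inv (hc : c.Nodup) (x : unitriangular c R 1) (k : Fin n) :
    ((x⁻¹ * meridian R hc k * x : unitriangular c R 1) : (GapMatrix c R)ˣ)⁻¹.val =
      1 - conjKappa x k := by
  have : ((x⁻¹ * meridian R hc k * x : unitriangular c R 1) : (GapMatrix c R)ˣ)⁻¹ =
      ((x⁻¹ : unitriangular c R 1) : (GapMatrix c R)ˣ) * (meridian R hc k : (GapMatrix c R)ˣ)⁻¹ *
        (x : (GapMatrix c R)ˣ) := by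
    push_cast; group
  rw [this, Units.val_mul, Units.val_mul, coe_meridian_inv]
  simp only [conjKappa, mul_sub, mul_one, sub_mul]
  congr 1
  rw [← Units.val_mul, ← Subgroup.coe_mul]
  simp

/-- Products along words that are not sublists vanish. -/
theorem prod_eq_zero_of_supported (T : Fin n → GapMatrix c R)
    (hT : ∀ k, Supported (fun y => [k].Sublist y) (T k)) (d : List (Fin n))
    (hd : ¬ d.Sublist c) : (d.map T).prod = 0 := by
  have h : Supported (fun y => d.Sublist y) (d.map T).prod := by
    clear hd
    induction d with
    | nil => exact supported_one (List.nil_sublist _)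
    | cons k d ih =>
      rw [List.map_cons, List.prod_cons]
      exact Supported.mul (fun x y hx hy => hx.append hy) (hT k) ih
  exact h.eq_zero fun e he hde => hd (hde.trans he)

/-- Both κ_k and its conjugate live on intervals that contain k. Their products in either order
would live on intervals containing k twice, hence vanish. -/
theorem commute_conj_meridian (hc : c.Nodup) (k : Fin n) (x : unitriangular c R 1) :
    Commute (x⁻¹ * meridian R hc k * x) (meridian R hc k) := by
  have h1 := supported_conjKappa x k
  have h2 : Supported (fun y => [k].Sublist y) (kappa c R k) :=
    (supported_kappa k).mono (by rintro _ rfl; simp)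
  have hno : ∀ d : List (Fin n), d.Sublist c → ¬ [k, k].Sublist d := fun d hd h => by
    have := (h.trans hd).nodup hc
    simp at this
  have e1 := (Supported.mul (W := fun y => [k, k].Sublist y)
    (fun x y hx hy => hx.append hy) h1 h2).eq_zero hno
  have e2 := (Supported.mul (W := fun y => [k, k].Sublist y)
    (fun x y hx hy => hx.append hy) h2 h1).eq_zero hno
  refine Subtype.ext (Units.ext ?_)
  rw [Subgroup.coe_mul _ (x⁻¹ * meridian R hc k * x), Subgroup.coe_mul _ (meridian R hc k),
    Units.val_mul, Units.val_mul, coe_conj_meridian, coe_meridian]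
  simp only [mul_add, add_mul, e1, e2, mul_one, one_mul]
  abel

/-- The entries of the value of a word are coefficients of its expansion. -/
theorem eval_meridian_apply (hc : c.Nodup) (w : SignedWord (Fin n)) (a b : Fin (c.length + 1))
    (hab : a ≤ b) :
    ((SignedWord.eval (meridian R hc) w : unitriangular c R 1) : (GapMatrix c R)ˣ).val a b =
      ((NCSeries.phi w (gapInterval c a b) : ℤ) : R) := by
  have h := NCSeries.eval_eq_sum c hc (kappa c R) (fun k => (meridian R hc k : (GapMatrix c R)ˣ))
    (coe_meridian hc) (coe_meridian_inv hc)
    (prod_eq_zero_of_supported _ fun k => (supported_kappa k).mono (by rintro _ rfl; simp)) w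
  have e := SignedWord.map_eval (unitriangular c R 1).subtype (meridian R hc) w
  simp only [Subgroup.subtype_apply] at e
  rw [e, h, Matrix.sum_apply, Finset.sum_eq_single (gapInterval c a b)]
  · rw [← zsmul_eq_mul, Matrix.smul_apply, prod_kappa]
    simp [hab]
  · intro d _ hd
    rw [← zsmul_eq_mul, Matrix.smul_apply, prod_kappa]
    simp [hd]
  · intro h
    simp [gapInterval_sublist] at h

end Unitriangular

open scoped commutatorElement

/-! ### Conjugation up to the normal closure -/

section ConjBy

variable {G : Type*} [Group G]

/-- An element commutes with all its conjugates. -/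
def CommutesWithConjugates (a : G) : Prop := ∀ x : G, Commute (x⁻¹ * a * x) a

/-- The conjugate `x⁻¹ a x`, as a function of the class of `x` modulo the normal closure of `a`
(well defined if `a` commutes with its conjugates). -/
noncomputable def conjBy (a : G) (q : G ⧸ Subgroup.normalClosure {a}) : G :=
  q.out⁻¹ * a * q.out

variable {a : G}

/-- The centralizer of `a` contains the conjugates of `a`, which generate the normal closure. This
is what makes `conjBy` independent of the chosen representative. -/
theorem CommutesWithConjugates.commute_of_mem (ha : CommutesWithConjugates a) {z : G}
    (hz : z ∈ Subgroup.normalClosure {a}) : Commute z a := by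
  have h : Subgroup.normalClosure {a} ≤ Subgroup.centralizer {a} := by
    unfold Subgroup.normalClosure
    rw [Subgroup.closure_le]
    intro y hy
    obtain ⟨b, hb, hby⟩ := Group.mem_conjugatesOfSet_iff.1 hy
    obtain ⟨x, rfl⟩ := isConj_iff.1 hby
    rw [Set.mem_singleton_iff] at hb
    subst hb
    rw [SetLike.mem_coe, Subgroup.mem_centralizer_singleton_iff]
    simpa using (ha x⁻¹).eq
  exact Subgroup.mem_centralizer_singleton_iff.1 (h hz)

theorem CommutesWithConjugates.conjBy_mk (ha : CommutesWithConjugates a) (x : G) :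
    conjBy a (x : G ⧸ Subgroup.normalClosure {a}) = x⁻¹ * a * x := by
  obtain ⟨z, hz⟩ := QuotientGroup.mk_out_eq_mul (Subgroup.normalClosure {a}) x
  have h1 : x * z * x⁻¹ ∈ Subgroup.normalClosure {a} :=
    Subgroup.Normal.conj_mem inferInstance _ z.2 x
  have h2 := (ha.commute_of_mem h1).eq
  rw [conjBy, hz]
  calc (x * (z : G))⁻¹ * a * (x * z) = x⁻¹ * (x * z * x⁻¹)⁻¹ * (a * (x * z * x⁻¹)) * x := by group
    _ = _ := by rw [← h2]; group

theorem CommutesWithConjugates.conjBy_mul (ha : CommutesWithConjugates a)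
    (q : G ⧸ Subgroup.normalClosure {a}) (y : G) :
    conjBy a (q * y) = y⁻¹ * conjBy a q * y := by
  obtain ⟨x, rfl⟩ := QuotientGroup.mk_surjective q
  rw [← QuotientGroup.mk_mul, ha.conjBy_mk, ha.conjBy_mk]
  group

theorem CommutesWithConjugates.commute_conjBy (ha : CommutesWithConjugates a)
    (q r : G ⧸ Subgroup.normalClosure {a}) : Commute (conjBy a q) (conjBy a r) := by
  obtain ⟨x, rfl⟩ := QuotientGroup.mk_surjective q
  obtain ⟨y, rfl⟩ := QuotientGroup.mk_surjective r
  rw [ha.conjBy_mk, ha.conjBy_mk]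
  have h := (ha (x * y⁻¹)).map (MulAut.conj y⁻¹).toMonoidHom
  simp only [MulEquiv.toMonoidHom_eq_coe, MonoidHom.coe_coe, MulAut.conj_apply, inv_inv] at h
  convert h using 1
  group

theorem mk_conjBy (q : G ⧸ Subgroup.normalClosure {a}) :
    ((conjBy a q : G) : G ⧸ Subgroup.normalClosure {a}) = 1 := by
  rw [QuotientGroup.eq_one_iff, conjBy]
  have := Subgroup.Normal.conj_mem (H := Subgroup.normalClosure {a}) inferInstance a
    (Subgroup.subset_normalClosure rfl) q.out⁻¹
  simpa using this

end ConjBy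

/-! ### Conditions along a word -/

section Scan

variable {Q L : Type*} [Group Q]

/-- The condition `P q A` holds for each letter `A` of a word, where `q` is the product of a
start value and the values of the preceding letters. -/
def Scan (P : Q → L → Prop) (v : L → Q) : Q → List L → Prop
  | _, [] => True
  | q, A :: l => P q A ∧ Scan P v (q * v A) l

theorem scan_append {P : Q → L → Prop} {v : L → Q} {q : Q} {l l' : List L} :
    Scan P v q (l ++ l') ↔ Scan P v q l ∧ Scan P v (q * (l.map v).prod) l' := by
  induction l generalizing q with
  | nil => simp [Scan]
  | cons A l ih => simp [Scan, ih, and_assoc, mul_assoc]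

theorem scan_iff {P : Q → L → Prop} {v : L → Q} {q : Q} {l : List L} :
    Scan P v q l ↔ ∀ x A y, l = x ++ A :: y → P (q * (x.map v).prod) A := by
  induction l generalizing q with
  | nil => simp [Scan]
  | cons B l ih =>
    simp only [Scan, ih]
    constructor
    · rintro ⟨h1, h2⟩ x A y h
      cases x with
      | nil =>
        obtain ⟨rfl, rfl⟩ := List.cons.inj h
        simpa using h1
      | cons C x =>
        obtain ⟨rfl, rfl⟩ := List.cons.inj h
        simpa [mul_assoc] using h2 x A y rfl
    · intro h
      refine ⟨by simpa using h [] B l rfl, fun x A y hl => ?_⟩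
      simpa [mul_assoc] using h (B :: x) A y (by simp [hl])

theorem Scan.congr {P P' : Q → L → Prop} {v v' : L → Q} {q : Q} {l : List L}
    (hP : ∀ A ∈ l, ∀ q, P q A → P' q A) (hv : ∀ A ∈ l, v A = v' A) (h : Scan P v q l) :
    Scan P' v' q l := by
  induction l generalizing q with
  | nil => trivial
  | cons A l ih =>
    refine ⟨hP A (by simp) _ h.1, ?_⟩
    rw [← hv A (by simp)]
    exact ih (fun B hB => hP B (by simp [hB])) (fun B hB => hv B (by simp [hB])) h.2

theorem scan_map {L' : Type*} {P : Q → L → Prop} {v : L → Q} {q : Q} {f : L' → L} {l : List L'} :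
    Scan P v q (l.map f) ↔ Scan (fun q A => P q (f A)) (fun A => v (f A)) q l := by
  induction l generalizing q with
  | nil => simp [Scan]
  | cons A l ih => simp [Scan, ih]

end Scan

/-! ### Letters and components -/

theorem isGauss_iff {L : Type u} [DecidableEq L] {n : ℕ} {w : Fin n → List L} :
    IsGauss w ↔ ∀ A, ∑ k, (w k).count A = 2 := by
  simp [IsGauss, List.count_flatten, List.map_ofFn, List.sum_ofFn]

namespace Nanophrase

variable {n : ℕ} (p : Nanophrase.{u} AlphaV n)

theorem eq_or_eq_of_mem {i j k : Fin n} {A : p.Letter} (hi : A ∈ p.word i) (hj : A ∈ p.word j)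
    (hij : i ≠ j) (hk : A ∈ p.word k) : k = i ∨ k = j := by
  by_contra! h
  have h2 := isGauss_iff.1 p.gauss A
  have h3 : ∑ l ∈ ({i, j, k} : Finset (Fin n)), (p.word l).count A ≤
      ∑ l, (p.word l).count A := Finset.sum_le_sum_of_subset (Finset.subset_univ _)
  rw [Finset.sum_insert (by simp [hij, h.1.symm]), Finset.sum_insert (by simp [h.2.symm]),
    Finset.sum_singleton] at h3
  have := List.count_pos_iff.2 hi
  have := List.count_pos_iff.2 hj
  have := List.count_pos_iff.2 hk
  omega

theorem count_eq_one {i j : Fin n} {A : p.Letter} (hi : A ∈ p.word i) (hj : A ∈ p.word j)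
    (hij : i ≠ j) : (p.word i).count A = 1 := by
  have h2 := isGauss_iff.1 p.gauss A
  have h3 : ∑ l ∈ ({i, j} : Finset (Fin n)), (p.word l).count A ≤
      ∑ l, (p.word l).count A := Finset.sum_le_sum_of_subset (Finset.subset_univ _)
  rw [Finset.sum_pair hij] at h3
  have := List.count_pos_iff.2 hi
  have := List.count_pos_iff.2 hj
  omega

/-- The sign of the first occurrence, if the occurrences are in different components. -/
def _root_.AlphaV.fstSign : AlphaV → SignType
  | .bp => 1
  | .am => -1
  | _ => 0

/-- The sign of the second occurrence, if the occurrences are in different components. -/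
def _root_.AlphaV.sndSign : AlphaV → SignType
  | .ap => 1
  | .bm => -1
  | _ => 0

theorem sign_fst {i j : Fin n} {A : p.Letter} (hj : A ∈ p.word j)
    (hij : i < j) : p.sign i A = (p.proj A).fstSign := by
  rw [sign, if_pos ⟨j, hij, hj⟩]; cases p.proj A <;> rfl

theorem sign_snd {i j : Fin n} {A : p.Letter} (hi : A ∈ p.word i) (hj : A ∈ p.word j)
    (hij : i < j) : p.sign j A = (p.proj A).sndSign := by
  rw [sign, if_neg, if_pos ⟨i, hij, hi⟩]
  · cases p.proj A <;> rfl
  · rintro ⟨k, hk, hAk⟩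
    rcases p.eq_or_eq_of_mem hi hj hij.ne hAk with rfl | rfl
    · exact absurd (hij.trans hk) (lt_irrefl _)
    · exact absurd hk (lt_irrefl _)

/-- The occurrences of the letter are in different components, and the one in the component `k` has
sign zero. -/
def IsOver (k : Fin n) (A : p.Letter) : Prop := p.sign k A = 0 ∧ ∃ j, j ≠ k ∧ A ∈ p.word j

theorem sign_eq_zero_of_forall {k : Fin n} {A : p.Letter} (h : ∀ j, A ∈ p.word j → j = k) :
    p.sign k A = 0 := by
  rw [sign, if_neg, if_neg]
  · rintro ⟨j, hj, hA⟩; exact hj.ne (h j hA)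
  · rintro ⟨j, hj, hA⟩; exact hj.ne' (h j hA)

theorem exists_mem_of_sign_ne_zero {k : Fin n} {A : p.Letter} (h : p.sign k A ≠ 0) :
    ∃ j, j ≠ k ∧ A ∈ p.word j := by
  by_contra! h'
  exact h (p.sign_eq_zero_of_forall fun j hj => by_contra fun hne => h' j hne hj)

theorem support_eq {i j : Fin n} {A : p.Letter} (hi : A ∈ p.word i) (hj : A ∈ p.word j)
    (hij : i ≠ j) : p.support A = {i, j} := by
  ext k
  simp only [support, Finset.mem_filter, Finset.mem_univ, true_and, Finset.mem_insert,
    Finset.mem_singleton]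
  exact ⟨p.eq_or_eq_of_mem hi hj hij, by rintro (rfl | rfl) <;> assumption⟩

theorem eta_of_lt {i j : Fin n} {A : p.Letter} (hi : A ∈ p.word i) (hj : A ∈ p.word j)
    (hij : i < j) : p.eta A = if (p.proj A).fstSign = 0 then i else j := by
  have hs := p.support_eq hi hj hij.ne
  have hmax : (p.support A).max' (p.support_nonempty A) = j := by
    simp only [hs]
    apply le_antisymm
    · apply Finset.max'_le; simp [hij.le]
    · apply Finset.le_max'; simp
  have hmin : (p.support A).min' (p.support_nonempty A) = i := by
    simp only [hs]
    apply le_antisymm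
    · apply Finset.min'_le; simp
    · apply Finset.le_min'; simp [hij.le]
  unfold eta
  rw [hmax, hmin]
  cases p.proj A <;> simp [AlphaV.fstSign]

theorem IsOver.eta_eq {p : Nanophrase.{u} AlphaV n} {k : Fin n} {A : p.Letter}
    (h : p.IsOver k A) (hk : A ∈ p.word k) : p.eta A = k := by
  obtain ⟨h1, j, hj, hA⟩ := h
  rcases lt_or_gt_of_ne hj with hlt | hlt
  · rw [p.sign_snd hA hk hlt] at h1
    rw [p.eta_of_lt hA hk hlt]
    revert h1
    cases p.proj A <;> simp [AlphaV.fstSign, AlphaV.sndSign]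
  · rw [p.sign_fst hA hlt] at h1
    rw [p.eta_of_lt hk hA hlt, if_pos h1]

/-- Each element of α_v gives sign zero to one of the two occurrences; that occurrence is where a
coloring prescribes the value of the letter. -/
theorem isOver_or_isOver {i j : Fin n} {A : p.Letter} (hi : A ∈ p.word i) (hj : A ∈ p.word j)
    (hij : i ≠ j) : p.IsOver i A ∨ p.IsOver j A := by
  wlog hlt : i < j generalizing i j
  · exact (this hj hi hij.symm (lt_of_le_of_ne (not_lt.1 hlt) hij.symm)).symm
  have h1 := p.sign_fst hj hlt
  have h2 := p.sign_snd hi hj hlt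
  have h3 : (p.proj A).fstSign = 0 ∨ (p.proj A).sndSign = 0 := by cases p.proj A <;> simp [AlphaV.fstSign, AlphaV.sndSign]
  exact h3.imp (fun h => ⟨h1.trans h, j, hij.symm, hj⟩) fun h => ⟨h2.trans h, i, hij, hi⟩

/-! ### Colorings -/

variable {G : Type*} [Group G] (g : Fin n → G) (m : p.Letter → G)

/-- The contribution of an occurrence of a letter in the component `k`. -/
def val (k : Fin n) (A : p.Letter) : G := m A ^ ((p.sign k A : SignType) : ℤ)

theorem eval_signedWord (k : Fin n) (w : List p.Letter) :
    SignedWord.eval m (p.signedWord k w) = (w.map (p.val m k)).prod := by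
  induction w with
  | nil => rfl
  | cons A w ih =>
    have e : p.signedWord k (A :: w) = p.signedWord k [A] ++ p.signedWord k w := by
      simp [signedWord]
    rw [e, SignedWord.eval_append, ih, List.map_cons, List.prod_cons]
    congr 1
    simp only [signedWord, List.flatMap_cons, List.flatMap_nil, List.append_nil, val]
    rcases p.sign k A with _ | _ | _ <;> simp [SignedWord.eval]

/-- A letter takes as value the conjugate of the value of the component of its occurrence of sign
zero, by the product along this component up to that occurrence. -/
def IsColoring : Prop :=
  ∀ k, Scan (fun q A => p.IsOver k A → m A = conjBy (g k) q)
    (fun A => ((p.val m k A : G) : G ⧸ Subgroup.normalClosure {g k})) 1 (p.word k)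

variable {p g m}

theorem isColoring_iff (hg : ∀ k, CommutesWithConjugates (g k)) :
    p.IsColoring g m ↔ ∀ k x A y, p.word k = x ++ A :: y → p.IsOver k A →
      m A = (x.map (p.val m k)).prod⁻¹ * g k * (x.map (p.val m k)).prod := by
  refine forall_congr' fun k => ?_
  rw [scan_iff]
  refine forall_congr' fun x => forall_congr' fun A => forall_congr' fun y =>
    imp_congr_right fun _ => imp_congr_right fun _ => ?_
  have : (x.map fun A => ((p.val m k A : G) : G ⧸ Subgroup.normalClosure {g k})).prod =
      ((x.map (p.val m k)).prod : G) := by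
    rw [← QuotientGroup.mk'_apply, map_list_prod, List.map_map]; rfl
  rw [one_mul, this, (hg k).conjBy_mk]

/-- If `x` and `y` agree modulo `γ_d`, then `x⁻¹ a x` and `y⁻¹ a y` agree modulo `γ_{d+1}`. -/
theorem conj_congr_lowerCentralSeries {d : ℕ} {a x y : G}
    (h : x⁻¹ * y ∈ (⊤ : Subgroup G).lowerCentralSeries d) :
    (x⁻¹ * a * x)⁻¹ * (y⁻¹ * a * y) ∈ (⊤ : Subgroup G).lowerCentralSeries (d + 1) := by
  have h1 : ⁅(x⁻¹ * y)⁻¹, (x⁻¹ * a * x)⁻¹⁆ ∈ (⊤ : Subgroup G).lowerCentralSeries (d + 1) :=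
    Subgroup.commutator_mem_commutator (inv_mem h) (Subgroup.mem_top _)
  have e : (x⁻¹ * a * x)⁻¹ * (y⁻¹ * a * y) = ⁅(x⁻¹ * y)⁻¹, (x⁻¹ * a * x)⁻¹⁆⁻¹ := by
    rw [commutatorElement_def]; group
  rw [e]
  exact inv_mem h1

/-- Two colorings have the same products along the components. -/
theorem IsColoring.val_eq [Group.IsNilpotent G] (hg : ∀ k, CommutesWithConjugates (g k))
    {m' : p.Letter → G} (hm : p.IsColoring g m) (hm' : p.IsColoring g m') {k : Fin n}
    {A : p.Letter} (hA : A ∈ p.word k) : p.val m k A = p.val m' k A := by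
  rw [isColoring_iff hg] at hm hm'
  -- Climb the lower central series: if partial products agree modulo γ_d, the conjugates that they
  -- define agree modulo γ_{d+1}, and hence so do the next partial products. Only the contributions
  -- can be compared, because the value of a letter within a single component is arbitrary.
  have key : ∀ d k x, (∃ y, p.word k = x ++ y) →
      (x.map (p.val m k)).prod⁻¹ * (x.map (p.val m' k)).prod ∈
        (⊤ : Subgroup G).lowerCentralSeries d := by
    intro d
    induction d with
    | zero => simp
    | succ d ih =>
      have hval : ∀ k A, A ∈ p.word k → (p.val m k A)⁻¹ * p.val m' k A ∈
          (⊤ : Subgroup G).lowerCentralSeries (d + 1) := by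
        intro k A hA
        by_cases hs : p.sign k A = 0
        · simp [val, hs]
        · obtain ⟨j, hjk, hj⟩ := p.exists_mem_of_sign_ne_zero hs
          have hover : p.IsOver j A :=
            (p.isOver_or_isOver hA hj hjk.symm).resolve_left fun h => hs h.1
          obtain ⟨x, y, hxy⟩ := List.append_of_mem hj
          have h1 := hm j x A y hxy hover
          have h2 := hm' j x A y hxy hover
          have h3 := conj_congr_lowerCentralSeries (a := g j) (ih j x ⟨_, hxy⟩)
          rw [← h1, ← h2, ← QuotientGroup.eq] at h3
          rw [← QuotientGroup.eq, val, val, QuotientGroup.mk_zpow, QuotientGroup.mk_zpow, h3]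
      rintro k x ⟨y, hxy⟩
      rw [← QuotientGroup.eq]
      have e : ∀ m : p.Letter → G, (((x.map (p.val m k)).prod : G) :
          G ⧸ (⊤ : Subgroup G).lowerCentralSeries (d + 1)) =
          (x.map fun A => ((p.val m k A : G) :
            G ⧸ (⊤ : Subgroup G).lowerCentralSeries (d + 1))).prod := by
        intro m
        rw [← QuotientGroup.mk'_apply, map_list_prod, List.map_map]; rfl
      rw [e, e]
      congr 1
      refine List.map_congr_left fun A hA => ?_
      rw [QuotientGroup.eq]
      exact hval k A (by rw [hxy]; simp [hA])
  obtain ⟨d, hd⟩ := Subgroup.nilpotent_iff_lowerCentralSeries.1 ‹Group.IsNilpotent G›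
  by_cases hs : p.sign k A = 0
  · simp [val, hs]
  · obtain ⟨j, hjk, hj⟩ := p.exists_mem_of_sign_ne_zero hs
    have hover : p.IsOver j A :=
      (p.isOver_or_isOver hA hj hjk.symm).resolve_left fun h => hs h.1
    obtain ⟨x, y, hxy⟩ := List.append_of_mem hj
    have h3 := key d j x ⟨_, hxy⟩
    rw [hd, Subgroup.mem_bot, inv_mul_eq_one] at h3
    rw [val, val, hm j x A y hxy hover, hm' j x A y hxy hover, h3]

/-- The truncation stops at the intended place because a letter that joins two components occurs
only once in each. -/
theorem before_eq {k : Fin n} {x y : List p.Letter} {A : p.Letter} (hk : p.word k = x ++ A :: y)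
    (h : p.IsOver k A) : p.before A = p.signedWord k x := by
  have hA : A ∈ p.word k := by rw [hk]; simp
  obtain ⟨j, hjk, hj⟩ := h.2
  have hx : A ∉ x := by
    intro hx
    have h1 := p.count_eq_one hA hj hjk.symm
    rw [hk, List.count_append, List.count_cons_self] at h1
    have := List.count_pos_iff.2 hx
    omega
  rw [before, h.eta_eq hA, hk, List.takeWhile_append_of_pos]
  · simp
  · intro B hB
    simp only [ne_eq, decide_eq_true_eq]
    rintro rfl
    exact hx hB

variable (p g)

/-- The value of a letter given by the `q`-th approximation. -/
def approxValue (q : ℕ) (A : p.Letter) : G := SignedWord.eval g (p.etaWord (p.rho q [(A, true)]))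

theorem eval_rho (q : ℕ) (w : SignedWord p.Letter) :
    SignedWord.eval g (p.etaWord (p.rho q w)) = SignedWord.eval (p.approxValue g q) w := by
  induction w with
  | nil => simp [rho_nil, etaWord]
  | cons a w ih =>
    rw [rho_cons, etaWord_append, SignedWord.eval_append, ih, SignedWord.eval_cons]
    congr 1
    obtain ⟨A, b⟩ := a
    cases b
    · have e : ([(A, false)] : SignedWord p.Letter) = SignedWord.inv [(A, true)] := rfl
      rw [e, rho_inv, etaWord_inv, SignedWord.eval_inv]; rfl
    · rfl

theorem approxValue_succ (q : ℕ) (hq : 2 ≤ q) (A : p.Letter) :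
    p.approxValue g (q + 1) A =
      (SignedWord.eval (p.approxValue g q) (p.before A))⁻¹ * g (p.eta A) *
        SignedWord.eval (p.approxValue g q) (p.before A) := by
  obtain ⟨q, rfl⟩ := Nat.exists_eq_add_of_le' hq
  have e : p.rho (q + 2 + 1) [(A, true)] =
      p.rho (q + 2) (p.before A).inv ++ ([(A, true)] ++ p.rho (q + 2) (p.before A)) := by
    simp [rho]
  rw [approxValue, e, etaWord_append, etaWord_append, SignedWord.eval_append,
    SignedWord.eval_append, eval_rho, eval_rho, SignedWord.eval_inv, mul_assoc]
  congr 2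
  simp [etaWord, SignedWord.eval]

/-- By `approxValue_succ`, raising q applies to the values the operator whose fixed points are
colorings. Each application gains one term of the lower central series, so the sequence becomes
stationary in a nilpotent group. -/
theorem exists_isColoring_approxValue [Group.IsNilpotent G]
    (hg : ∀ k, CommutesWithConjugates (g k)) :
    ∃ d, ∀ q, d ≤ q → p.IsColoring g (p.approxValue g q) := by
  -- The offset 2 is there because the recursion for ρ^q starts from ρ² = id.
  have key : ∀ d q, d + 2 ≤ q → ∀ A, (p.approxValue g q A)⁻¹ * p.approxValue g (q + 1) A ∈
      (⊤ : Subgroup G).lowerCentralSeries d := by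
    intro d
    induction d with
    | zero => simp
    | succ d ih =>
      intro q hq A
      obtain ⟨q, rfl⟩ := Nat.exists_eq_add_of_le' (show 1 ≤ q by omega)
      rw [approxValue_succ p g q (by omega), approxValue_succ p g (q + 1) (by omega)]
      refine conj_congr_lowerCentralSeries ?_
      rw [← QuotientGroup.eq, ← QuotientGroup.mk'_apply, ← QuotientGroup.mk'_apply,
        SignedWord.map_eval, SignedWord.map_eval]
      refine SignedWord.eval_congr fun a _ => ?_
      rw [QuotientGroup.mk'_apply, QuotientGroup.mk'_apply, QuotientGroup.eq]
      exact ih q (by omega) a.1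
  obtain ⟨d, hd⟩ := Subgroup.nilpotent_iff_lowerCentralSeries.1 ‹Group.IsNilpotent G›
  refine ⟨d + 2, fun q hq => ?_⟩
  rw [isColoring_iff hg]
  intro k x A y hxy hover
  have h := key d q hq A
  rw [hd, Subgroup.mem_bot, inv_mul_eq_one] at h
  have hA : A ∈ p.word k := by rw [hxy]; simp
  rw [h, approxValue_succ p g q (by omega), before_eq hxy hover, hover.eta_eq hA, eval_signedWord]

variable {p g}

/-- A coloring computes the values of the components. -/
theorem IsColoring.eval_component [Group.IsNilpotent G] (hg : ∀ k, CommutesWithConjugates (g k))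
    (hm : p.IsColoring g m) : ∃ d, ∀ q, d ≤ q → ∀ k,
      SignedWord.eval g (p.etaWord (p.rho q (p.signedWord k (p.word k)))) =
        ((p.word k).map (p.val m k)).prod := by
  obtain ⟨d, hd⟩ := p.exists_isColoring_approxValue g hg
  refine ⟨d, fun q hq k => ?_⟩
  rw [eval_rho, eval_signedWord]
  congr 1
  exact List.map_congr_left fun A hA => (hd q hq).val_eq hg hm hA

end Nanophrase

/-! ### Components of a phrase written in one line -/

namespace Token

variable {L : Type u}

/-- The number of bars. -/
def bars : List (Token L) → ℕ
  | [] => 0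
  | letter _ :: t => bars t
  | bar :: t => bars t + 1

/-- The letters of a sequence of symbols. -/
def letters : List (Token L) → List L
  | [] => []
  | letter A :: t => A :: letters t
  | bar :: t => letters t

/-- The letters in the component `k`, for a sequence of symbols that starts in the component `b`. -/
def component : ℕ → List (Token L) → ℕ → List L
  | _, [], _ => []
  | b, letter A :: t, k => (if b = k then [A] else []) ++ component b t k
  | b, bar :: t, k => component (b + 1) t k

theorem bars_append (t t' : List (Token L)) : bars (t ++ t') = bars t + bars t' := by
  induction t with
  | nil => simp [bars]
  | cons a t ih => cases a <;> simp [bars, ih]; omega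

theorem letters_append (t t' : List (Token L)) : letters (t ++ t') = letters t ++ letters t' := by
  induction t with
  | nil => simp [letters]
  | cons a t ih => cases a <;> simp [letters, ih]

theorem component_append (b k : ℕ) (t t' : List (Token L)) :
    component b (t ++ t') k = component b t k ++ component (b + bars t) t' k := by
  induction t generalizing b with
  | nil => simp [component, bars]
  | cons a t ih =>
    cases a
    · simp [component, bars, ih]
    · simp only [List.cons_append, component, bars, ih]
      rw [show b + 1 + bars t = b + (bars t + 1) by omega]

theorem component_map {L' : Type u} (f : L → L') (b k : ℕ) (t : List (Token L)) :
    component b (t.map (Token.map f)) k = (component b t k).map f := by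
  induction t generalizing b with
  | nil => simp [component]
  | cons a t ih =>
    cases a
    · simp only [List.map_cons, Token.map, component, ih, List.map_append]
      split_ifs <;> simp
    · simp [Token.map, component, ih]

theorem mem_letters_of_mem_component {b k : ℕ} {t : List (Token L)} {A : L}
    (h : A ∈ component b t k) : A ∈ letters t := by
  induction t generalizing b with
  | nil => simp [component] at h
  | cons a t ih =>
    cases a
    · simp only [component, List.mem_append] at h
      rcases h with h | h
      · split_ifs at h <;> simp_all [letters]
      · simp [letters, ih h]
    · exact ih h

theorem component_map_letter (b k : ℕ) (l : List L) :
    component b (l.map letter) k = if b = k then l else [] := by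
  induction l with
  | nil => simp [component]
  | cons A l ih =>
    simp only [List.map_cons, component, ih]
    split_ifs <;> simp

theorem bars_map_letter (l : List L) : bars (l.map letter) = 0 := by
  induction l with
  | nil => rfl
  | cons A l ih => simpa [bars] using ih

theorem letters_map_letter (l : List L) : letters (l.map letter) = l := by
  induction l with
  | nil => rfl
  | cons A l ih => simp [letters, ih]

theorem ofOption_eq (A : Option L) : ofOption A = A.toList.map letter := by
  cases A <;> rfl

theorem component_intercalate (ls : List (List L)) (b k : ℕ) :
    component b ([bar].intercalate (ls.map (List.map letter))) k =
      if b ≤ k then ls.getD (k - b) [] else [] := by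
  induction ls generalizing b with
  | nil => simp [component, List.intercalate]
  | cons l ls ih =>
    cases ls with
    | nil =>
      simp only [List.intercalate, List.map_cons, List.map_nil, List.intersperse_singleton,
        List.flatten_cons, List.flatten_nil, List.append_nil, component_map_letter]
      rcases lt_trichotomy b k with h | h | h
      · obtain ⟨d, rfl⟩ := Nat.exists_eq_add_of_lt h
        simp [show b + d + 1 - b = d + 1 by omega]
        omega
      · simp [h]
      · simp [h.ne', h.not_ge]
    | cons l' ls =>
      have e : [bar].intercalate ((l :: l' :: ls).map (List.map letter)) =
          l.map letter ++ ([bar] ++ [bar].intercalate ((l' :: ls).map (List.map letter))) := by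
        simp [List.intercalate]
      rw [e, component_append, component_append, ih, component_map_letter, bars_map_letter]
      simp only [component, bars, List.nil_append]
      rcases lt_trichotomy b k with h | h | h
      · obtain ⟨d, rfl⟩ := Nat.exists_eq_add_of_lt h
        simp only [show b + d + 1 - b = d + 1 by omega, List.getD_cons_succ,
          show b + d + 1 - (b + 1) = d by omega]
        rw [if_neg (by omega), if_pos (by omega), if_pos (by omega)]
        rfl
      · simp [h]
      · simp [h.ne', h.not_ge, show ¬ b + 1 ≤ k by omega]

theorem letters_intercalate (ls : List (List L)) :
    letters ([bar].intercalate (ls.map (List.map letter))) = ls.flatten := by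
  induction ls with
  | nil => simp [letters, List.intercalate]
  | cons l ls ih =>
    cases ls with
    | nil => simp [List.intercalate, letters_map_letter]
    | cons l' ls =>
      have e : [bar].intercalate ((l :: l' :: ls).map (List.map letter)) =
          l.map letter ++ ([bar] ++ [bar].intercalate ((l' :: ls).map (List.map letter))) := by
        simp [List.intercalate]
      rw [e, letters_append, letters_append, ih, letters_map_letter]
      simp [letters]

end Token

section Flat

variable {L : Type u} {n : ℕ}

theorem flatPhrase_eq (w : Fin n → List L) :
    flatPhrase w = [Token.bar].intercalate ((List.ofFn w).map (List.map Token.letter)) := by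
  rw [flatPhrase, List.map_ofFn]; rfl

theorem component_flatPhrase (w : Fin n → List L) (k : Fin n) :
    Token.component 0 (flatPhrase w) k = w k := by
  rw [flatPhrase_eq, Token.component_intercalate]
  simp

theorem lt_of_mem_component_flatPhrase {w : Fin n → List L} {j : ℕ} {A : L}
    (h : A ∈ Token.component 0 (flatPhrase w) j) : j < n := by
  rw [flatPhrase_eq, Token.component_intercalate] at h
  by_contra hj
  simp [show n ≤ j by omega] at h

theorem count_letters_flatPhrase [DecidableEq L] {w : Fin n → List L} (hw : IsGauss w) (A : L) :
    (Token.letters (flatPhrase w)).count A = 2 := by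
  rw [flatPhrase_eq, Token.letters_intercalate]
  exact hw A

end Flat

/-! ### Replacing pieces of the words -/

/-- A move changes a phrase in at most three blocks, of which the component `k` sees those with
index `k`. If old and new block have the same product, all later partial products, and thus all
conditions outside the blocks, are unaffected. -/
theorem scan_replace {Q L : Type*} [Group Q] {n : ℕ} {k I J K : Fin n}
    {b₁ b₁' b₂ b₂' b₃ b₃' x y z t : List L} {P P' : Q → L → Prop} {v v' : L → Q}
    (hP : ∀ A, A ∈ x ∨ A ∈ y ∨ A ∈ z ∨ A ∈ t → ∀ q, P q A → P' q A)
    (hv : ∀ A, A ∈ x ∨ A ∈ y ∨ A ∈ z ∨ A ∈ t → v A = v' A)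
    (h₁ : I = k → (b₁.map v).prod = (b₁'.map v').prod ∧ ∀ q, Scan P v q b₁ → Scan P' v' q b₁')
    (h₂ : J = k → (b₂.map v).prod = (b₂'.map v').prod ∧ ∀ q, Scan P v q b₂ → Scan P' v' q b₂')
    (h₃ : K = k → (b₃.map v).prod = (b₃'.map v').prod ∧ ∀ q, Scan P v q b₃ → Scan P' v' q b₃')
    {w w' : List L}
    (hw : w = x ++ (if I = k then b₁ else []) ++ y ++ (if J = k then b₂ else []) ++ z ++
      (if K = k then b₃ else []) ++ t)
    (hw' : w' = x ++ (if I = k then b₁' else []) ++ y ++ (if J = k then b₂' else []) ++ z ++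
      (if K = k then b₃' else []) ++ t)
    (h : Scan P v 1 w) : Scan P' v' 1 w' ∧ (w.map v).prod = (w'.map v').prod := by
  have hb : ∀ (I : Fin n) (b b' : List L),
      (I = k → (b.map v).prod = (b'.map v').prod ∧ ∀ q, Scan P v q b → Scan P' v' q b') →
      ((if I = k then b else []).map v).prod = ((if I = k then b' else []).map v').prod ∧
        ∀ q, Scan P v q (if I = k then b else []) → Scan P' v' q (if I = k then b' else []) := by
    intro I b b' h
    split_ifs with hI
    · exact h hI
    · exact ⟨rfl, fun _ _ => trivial⟩
  have hx : ∀ l : List L, (∀ A ∈ l, A ∈ x ∨ A ∈ y ∨ A ∈ z ∨ A ∈ t) →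
      (l.map v).prod = (l.map v').prod ∧ ∀ q, Scan P v q l → Scan P' v' q l := fun l hl =>
    ⟨congrArg _ (List.map_congr_left fun A hA => hv A (hl A hA)),
      fun q h => h.congr (fun A hA => hP A (hl A hA)) fun A hA => hv A (hl A hA)⟩
  have := hb I _ _ h₁
  have := hb J _ _ h₂
  have := hb K _ _ h₃
  have := hx x (fun _ h => .inl h)
  have := hx y (fun _ h => .inr (.inl h))
  have := hx z (fun _ h => .inr (.inr (.inl h)))
  have := hx t (fun _ h => .inr (.inr (.inr h)))
  subst hw hw'
  simp only [scan_append, List.map_append, List.prod_append] at h ⊢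
  simp_all

theorem exists_scan_of_replace {Q L : Type*} [Group Q] {n : ℕ} {k I J K : Fin n}
    {b₁ b₂ b₃ x y z t : List L} {P : Q → L → Prop} {v : L → Q} {w : List L}
    (hw : w = x ++ (if I = k then b₁ else []) ++ y ++ (if J = k then b₂ else []) ++ z ++
      (if K = k then b₃ else []) ++ t)
    (h : Scan P v 1 w) : (I = k → ∃ q, Scan P v q b₁) ∧ (J = k → ∃ q, Scan P v q b₂) ∧
      (K = k → ∃ q, Scan P v q b₃) := by
  subst hw
  simp only [scan_append] at h
  obtain ⟨⟨⟨⟨⟨⟨-, h1⟩, -⟩, h2⟩, -⟩, h3⟩, -⟩ := h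
  refine ⟨fun hI => ?_, fun hJ => ?_, fun hK => ?_⟩
  · rw [if_pos hI] at h1; exact ⟨_, h1⟩
  · rw [if_pos hJ] at h2; exact ⟨_, h2⟩
  · rw [if_pos hK] at h3; exact ⟨_, h3⟩

/-! ### Moves that do not change the base points -/

namespace Nanophrase

variable {n : ℕ} {p p' : Nanophrase.{u} AlphaV n}

theorem sign_transfer (f : p'.Letter → p.Letter) {X : p'.Letter} (hproj : p'.proj X = p.proj (f X))
    (hmem : ∀ k, X ∈ p'.word k ↔ f X ∈ p.word k) (k : Fin n) :
    p'.sign k X = p.sign k (f X) := by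
  simp only [sign, hproj, hmem]

theorem isOver_transfer (f : p'.Letter → p.Letter) {X : p'.Letter} {k : Fin n}
    (hsign : p'.sign k X = p.sign k (f X)) (hmem : ∀ k, X ∈ p'.word k ↔ f X ∈ p.word k) :
    p'.IsOver k X ↔ p.IsOver k (f X) := by
  simp only [IsOver, hsign, hmem]

variable {G : Type*} [Group G]

/-- The condition that a coloring imposes on an occurrence. -/
def OverCondition (p : Nanophrase.{u} AlphaV n) (g : Fin n → G) (m : p.Letter → G) (k : Fin n)
    (q : G ⧸ Subgroup.normalClosure {g k}) (A : p.Letter) : Prop :=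
  p.IsOver k A → m A = conjBy (g k) q

/-- The class of the contribution of an occurrence. -/
def valClass (p : Nanophrase.{u} AlphaV n) (g : Fin n → G) (m : p.Letter → G) (k : Fin n)
    (A : p.Letter) : G ⧸ Subgroup.normalClosure {g k} := (p.val m k A : G)

/-- Each coloring of `p` gives a coloring of `p'` with equivalent values of the components. -/
def TransfersTo (p p' : Nanophrase.{u} AlphaV n) : Prop :=
  ∀ (G : Type) [Group G] (g : Fin n → G), (∀ k, CommutesWithConjugates (g k)) →
    ∀ m, p.IsColoring g m → ∃ m', p'.IsColoring g m' ∧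
      ∀ k, ((p.word k).map (p.valClass g m k)).prod = ((p'.word k).map (p'.valClass g m' k)).prod

/-- Pulling back along a map of letters. -/
theorem scan_transfer {g : Fin n → G} {m : p.Letter → G} (f : p'.Letter → p.Letter)
    (hmem : ∀ k X, X ∈ p'.word k ↔ f X ∈ p.word k)
    (hsign : ∀ k X, X ∈ p'.word k → p'.sign k X = p.sign k (f X)) (k : Fin n)
    (hscan : Scan (p.OverCondition g m k) (p.valClass g m k) 1 ((p'.word k).map f)) :
    Scan (p'.OverCondition g (fun X => m (f X)) k) (p'.valClass g (fun X => m (f X)) k) 1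
      (p'.word k) := by
  rw [scan_map] at hscan
  refine hscan.congr (fun X hX q h => ?_) fun X hX => ?_
  · intro ho
    apply h
    rwa [isOver_transfer f (hsign k X hX) (fun k => hmem k X)] at ho
  · simp only [valClass, val, hsign k X hX]

theorem prod_transfer {g : Fin n → G} {m : p.Letter → G} (f : p'.Letter → p.Letter)
    (hsign : ∀ k X, X ∈ p'.word k → p'.sign k X = p.sign k (f X)) (k : Fin n) :
    ((p'.word k).map (p'.valClass g (fun X => m (f X)) k)).prod =
      (((p'.word k).map f).map (p.valClass g m k)).prod := by
  rw [List.map_map]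
  congr 1
  refine List.map_congr_left fun X hX => ?_
  simp only [Function.comp, valClass, val, hsign k X hX]

theorem transfersTo_iso (f : p.Letter ≃ p'.Letter) (hproj : ∀ A, p'.proj (f A) = p.proj A)
    (hword : ∀ k, p'.word k = (p.word k).map f) : p.TransfersTo p' := by
  intro G _ g hg m hm
  have hmem : ∀ k X, X ∈ p'.word k ↔ f.symm X ∈ p.word k := by
    intro k X
    rw [hword]
    simp [List.mem_map, ← Equiv.eq_symm_apply]
  have hsign : ∀ k X, X ∈ p'.word k → p'.sign k X = p.sign k (f.symm X) := fun k X _ =>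
    sign_transfer _ (by rw [← hproj, Equiv.apply_symm_apply]) (fun k => hmem k X) k
  have hw : ∀ k, (p'.word k).map f.symm = p.word k := by
    intro k; rw [hword]; simp
  refine ⟨fun X => m (f.symm X), fun k => ?_, fun k => ?_⟩
  · exact scan_transfer _ hmem hsign k (by rw [hw]; exact hm k)
  · rw [prod_transfer _ hsign, hw]

theorem sign_eq_zero_of_two_le {k : Fin n} {A : p.Letter} (h : 2 ≤ (p.word k).count A) :
    (∀ j, A ∈ p.word j → j = k) := by
  intro j hj
  by_contra hne
  have := p.count_eq_one (List.count_pos_iff.1 (by omega)) hj (Ne.symm hne)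
  omega

theorem valClass_eq_one {g : Fin n → G} {m : p.Letter → G} {k : Fin n} {A : p.Letter}
    (h : p.sign k A = 0) : p.valClass g m k A = 1 := by
  simp [valClass, val, h]

/-- A letter that occurs twice in one component contributes nothing and is subject to no condition,
whatever its projection is. -/
theorem transfersTo_selfCrossing (L : Type u) [DecidableEq L] (proj : L → AlphaV)
    (w : Fin n → List L) (hw : IsGauss w) (k : Fin n) (A : L) (x y z : List L)
    (hk : w k = x ++ [A] ++ y ++ [A] ++ z) (α : AlphaV) :
    TransfersTo (⟨L, proj, w, hw⟩ : Nanophrase AlphaV n) ⟨L, Function.update proj A α, w, hw⟩ := by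
  intro G _ g hg m hm
  have h2 : 2 ≤ (w k).count A := by rw [hk]; simp [List.count_append]; omega
  have hsign : ∀ j (X : L), X ∈ w j →
      (⟨L, Function.update proj A α, w, hw⟩ : Nanophrase AlphaV n).sign j X =
        (⟨L, proj, w, hw⟩ : Nanophrase AlphaV n).sign j X := by
    intro j X hX
    by_cases hXA : X = A
    · subst hXA
      have e := sign_eq_zero_of_two_le (p := ⟨L, proj, w, hw⟩) h2
      obtain rfl := e j hX
      exact (sign_eq_zero_of_forall ⟨L, Function.update proj X α, w, hw⟩ e).trans
        (sign_eq_zero_of_forall _ e).symm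
    · exact sign_transfer (p := ⟨L, proj, w, hw⟩)
        (p' := ⟨L, Function.update proj A α, w, hw⟩) id (Function.update_of_ne hXA _ _)
        (fun _ => Iff.rfl) j
  refine ⟨m, fun j => ?_, fun j => ?_⟩
  · exact scan_transfer (p := ⟨L, proj, w, hw⟩)
      (p' := ⟨L, Function.update proj A α, w, hw⟩) id (fun _ _ => Iff.rfl) hsign j
      (by
        change Scan _ _ 1 ((w j).map id)
        rw [List.map_id]
        exact hm j)
  · have := prod_transfer (p := ⟨L, proj, w, hw⟩) (g := g) (m := m)
      (p' := ⟨L, Function.update proj A α, w, hw⟩) id hsign j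
    simpa using this.symm

end Nanophrase

/-! ### Cutting a phrase into blocks; the first and second moves -/

section FlatPieces

variable {L : Type u} {n : ℕ}

open Token

/-- The alternative in `hK` serves the moves with only two blocks: an empty third block may be
assigned to any component. -/
theorem component_eq_of_flat {s x y z t : List (Token L)} {l₁ l₂ l₃ : List L}
    (hs : s = x ++ l₁.map letter ++ y ++ l₂.map letter ++ z ++ l₃.map letter ++ t)
    {I J K : Fin n} (hI : (I : ℕ) = bars x) (hJ : (J : ℕ) = bars x + bars y)
    (hK : l₃ = [] ∨ (K : ℕ) = bars x + bars y + bars z) (k : Fin n) :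
    component 0 s k = component 0 x k ++ (if I = k then l₁ else []) ++ component (bars x) y k ++
      (if J = k then l₂ else []) ++ component (bars x + bars y) z k ++
      (if K = k then l₃ else []) ++ component (bars x + bars y + bars z) t k := by
  subst hs
  simp only [component_append, bars_append, component_map_letter, bars_map_letter, Nat.zero_add,
    Nat.add_zero, Fin.ext_iff, hI, hJ]
  rcases hK with rfl | hK
  · simp
  · rw [hK]

theorem lt_of_flat {w : Fin n → List L} {x t : List (Token L)} {l : List L} (hl : l ≠ [])
    (hw : flatPhrase w = x ++ l.map letter ++ t) : bars x < n := by
  obtain ⟨A, hA⟩ := List.exists_mem_of_ne_nil l hl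
  refine lt_of_mem_component_flatPhrase (w := w) (A := A) ?_
  rw [hw]
  simp [component_append, component_map_letter, hA]

end FlatPieces

namespace Nanophrase

variable {n : ℕ} {p p' : Nanophrase.{u} AlphaV n}

open Token

/-- Deleting blocks whose contributions have product 1 leaves every other partial product unchanged,
so the restricted values are again a coloring. -/
theorem transfersTo_deletion (f : p'.Letter → p.Letter) (hf : Function.Injective f)
    (hproj : ∀ X, p'.proj X = p.proj (f X)) {b₁ b₂ : List p.Letter}
    (hb : ∀ X, f X ∉ b₁ ∧ f X ∉ b₂) {x y z : List (Token p.Letter)}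
    (hp : flatPhrase p.word = x ++ b₁.map letter ++ y ++ b₂.map letter ++ z)
    (hp' : (flatPhrase p'.word).map (Token.map f) = x ++ y ++ z)
    {I J : Fin n} (hI : (I : ℕ) = bars x) (hJ : (J : ℕ) = bars x + bars y)
    (hprod : ∀ {G : Type} [Group G] (g : Fin n → G), (∀ k, CommutesWithConjugates (g k)) →
      ∀ m, p.IsColoring g m → (b₁.map (p.valClass g m I)).prod = 1 ∧
        (b₂.map (p.valClass g m J)).prod = 1) : p.TransfersTo p' := by
  intro G _ g hg m hm
  have hw : ∀ k, p.word k = _ := fun k => (component_flatPhrase p.word k).symm.trans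
    (component_eq_of_flat (x := x) (y := y) (z := z) (t := []) (l₁ := b₁) (l₂ := b₂) (l₃ := [])
      (K := J) (by rw [hp]; simp) hI hJ (.inl rfl) k)
  have hw' : ∀ k, (p'.word k).map f = _ := fun k =>
    ((by rw [← hp', component_map, component_flatPhrase] :
      (p'.word k).map f = component 0 (x ++ y ++ z) k)).trans
    (component_eq_of_flat (x := x) (y := y) (z := z) (t := []) (l₁ := []) (l₂ := []) (l₃ := [])
      (K := J) (by simp) hI hJ (.inl rfl) k)
  have hmem : ∀ k X, X ∈ p'.word k ↔ f X ∈ p.word k := by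
    intro k X
    rw [← List.mem_map_of_injective hf, hw, hw']
    have h1 : f X ∉ (if I = k then b₁ else []) := by split_ifs <;> simp [hb X]
    have h2 : f X ∉ (if J = k then b₂ else []) := by split_ifs <;> simp [hb X]
    simp [h1, h2]
  have hsign : ∀ k X, X ∈ p'.word k → p'.sign k X = p.sign k (f X) := fun k X _ =>
    sign_transfer _ (hproj X) (fun k => hmem k X) k
  obtain ⟨h1, h2⟩ := hprod g hg m hm
  have key := fun k => scan_replace (P := p.OverCondition g m k) (P' := p.OverCondition g m k)
    (v := p.valClass g m k) (v' := p.valClass g m k) (fun _ _ _ h => h) (fun _ _ => rfl)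
    (fun hk => by subst hk; exact ⟨h1, fun _ _ => trivial⟩)
    (fun hk => by subst hk; exact ⟨h2, fun _ _ => trivial⟩)
    (b₃ := []) (b₃' := []) (fun _ => ⟨rfl, fun _ _ => trivial⟩) (hw k) (hw' k) (hm k)
  refine ⟨fun X => m (f X), fun k => scan_transfer f hmem hsign k (key k).1, fun k => ?_⟩
  rw [prod_transfer f hsign, (key k).2]

theorem transfersTo_h1 (A : p.Letter) (f : p'.Letter ≃ {X : p.Letter // X ≠ A})
    (hproj : ∀ X, p'.proj X = p.proj (f X)) (x y : List (Token p.Letter))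
    (hp : flatPhrase p.word = x ++ [.letter A, .letter A] ++ y)
    (hp' : (flatPhrase p'.word).map (Token.map fun X => (f X : p.Letter)) = x ++ y) :
    p.TransfersTo p' := by
  have hlt := lt_of_flat (w := p.word) (l := [A, A]) (t := y) (by simp) hp
  set I : Fin n := ⟨bars x, hlt⟩ with hI
  refine transfersTo_deletion (fun X => (f X : p.Letter))
    (Subtype.val_injective.comp f.injective) hproj (b₁ := [A, A]) (b₂ := []) (x := x) (y := [])
    (z := y) (fun X => by simp [(f X).2]) (by simp [hp]) (by simpa using hp') (I := I) (J := I)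
    rfl (by simp [bars, hI]) ?_
  intro G _ g hg m hm
  have hw := (component_flatPhrase p.word I).symm
  rw [hp] at hw
  have h2 : 2 ≤ (p.word I).count A := by
    rw [hw]
    simp [component_append, component, hI, bars]
    omega
  have hs := sign_eq_zero_of_forall p (sign_eq_zero_of_two_le h2)
  simp [valClass_eq_one (g := g) (m := m) hs]

/-- The involution τ makes both letters over in the same component, with opposite signs in the
other. Being adjacent where they are over, they have the same value, so their contributions in the
other component cancel. If both blocks lie in one component, all signs are zero. -/
theorem transfersTo_h2 (A B : p.Letter) (hτ : AlphaV.tau (p.proj A) = p.proj B)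
    (f : p'.Letter ≃ {X : p.Letter // X ≠ A ∧ X ≠ B})
    (hproj : ∀ X, p'.proj X = p.proj (f X)) (x y z : List (Token p.Letter))
    (hp : flatPhrase p.word =
      x ++ [.letter A, .letter B] ++ y ++ [.letter B, .letter A] ++ z)
    (hp' : (flatPhrase p'.word).map (Token.map fun X => (f X : p.Letter)) = x ++ y ++ z) :
    p.TransfersTo p' := by
  have hI := lt_of_flat (w := p.word) (l := [A, B]) (x := x) (by simp)
    (t := y ++ [.letter B, .letter A] ++ z) (by rw [hp]; simp)
  have hJ := lt_of_flat (w := p.word) (l := [B, A]) (x := x ++ [.letter A, .letter B] ++ y)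
    (by simp) (t := z) (by rw [hp]; simp)
  obtain ⟨I, hI⟩ : ∃ I : Fin n, (I : ℕ) = bars x := ⟨⟨_, hI⟩, rfl⟩
  obtain ⟨J, hJ⟩ : ∃ J : Fin n, (J : ℕ) = bars x + bars y :=
    ⟨⟨_, hJ⟩, by simp [bars_append, bars]⟩
  refine transfersTo_deletion (fun X => (f X : p.Letter))
    (Subtype.val_injective.comp f.injective) hproj (b₁ := [A, B]) (b₂ := [B, A]) (x := x) (y := y)
    (z := z) (fun X => by simp [(f X).2]) (by simp [hp]) hp' hI hJ ?_
  intro G _ g hg m hm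
  have hw : ∀ k, p.word k = _ := fun k => (component_flatPhrase p.word k).symm.trans
    (component_eq_of_flat (x := x) (y := y) (z := z) (l₁ := [A, B]) (l₂ := [B, A]) (t := []) (l₃ := []) (K := J)
      (by rw [hp]; simp) hI hJ (.inl rfl) k)
  obtain ⟨hsI, hsJ, -⟩ := exists_scan_of_replace (hw I) (hm I)
  obtain ⟨-, hsJ, -⟩ := exists_scan_of_replace (hw J) (hm J)
  obtain ⟨qI, hqI⟩ := hsI rfl
  obtain ⟨qJ, hqJ⟩ := hsJ rfl
  rcases eq_or_lt_of_le (show I ≤ J by rw [Fin.le_def]; omega) with hIJ | hIJ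
  · subst hIJ
    have hA : 2 ≤ (p.word I).count A := by
      rw [hw]; simp [List.count_cons]; omega
    have hB : 2 ≤ (p.word I).count B := by
      rw [hw]; simp [List.count_cons]; omega
    have hsA := sign_eq_zero_of_forall p (sign_eq_zero_of_two_le hA)
    have hsB := sign_eq_zero_of_forall p (sign_eq_zero_of_two_le hB)
    simp [valClass_eq_one (g := g) (m := m) hsA, valClass_eq_one (g := g) (m := m) hsB]
  · have hAI : A ∈ p.word I := by rw [hw]; simp
    have hBI : B ∈ p.word I := by rw [hw]; simp
    have hAJ : A ∈ p.word J := by rw [hw]; simp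
    have hBJ : B ∈ p.word J := by rw [hw]; simp
    have sAI := p.sign_fst hAJ hIJ
    have sBI := p.sign_fst hBJ hIJ
    have sAJ := p.sign_snd hAI hAJ hIJ
    have sBJ := p.sign_snd hBI hBJ hIJ
    simp only [Scan, and_true, IsOver, valClass, val, sAI, sBI, sAJ, sBJ] at hqI hqJ
    simp only [List.map_cons, List.map_nil, List.prod_cons, List.prod_nil, mul_one, valClass, val,
      sAI, sBI, sAJ, sBJ]
    have hIJ' : ∃ j, j ≠ I ∧ A ∈ p.word j := ⟨J, hIJ.ne', hAJ⟩
    have hIJB' : ∃ j, j ≠ I ∧ B ∈ p.word j := ⟨J, hIJ.ne', hBJ⟩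
    have hJI' : ∃ j, j ≠ J ∧ A ∈ p.word j := ⟨I, hIJ.ne, hAI⟩
    have hJIB' : ∃ j, j ≠ J ∧ B ∈ p.word j := ⟨I, hIJ.ne, hBI⟩
    generalize p.proj A = a at hτ hqI hqJ ⊢
    generalize p.proj B = b at hτ hqI hqJ ⊢
    subst hτ
    cases a <;> simp_all [AlphaV.tau, AlphaV.fstSign, AlphaV.sndSign]

end Nanophrase

/-! ### The third move: values of the letters -/

namespace Nanophrase

variable {n : ℕ}

theorem mul_zpow_mul_inv {H : Type*} [Group H] (x z : H) (i : ℤ) :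
    (x * (z * x⁻¹)) ^ i = x * (z ^ i * x⁻¹) := by
  rw [← mul_assoc, conj_zpow, mul_assoc]

theorem inv_mul_zpow_mul {H : Type*} [Group H] (x z : H) (i : ℤ) :
    (x⁻¹ * (z * x)) ^ i = x⁻¹ * (z ^ i * x) := by
  simpa using mul_zpow_mul_inv x⁻¹ z i

/-- The twelve triples without ∅ are the six height orders of three strands I, J, K, each with a
common sign `e`: A, B, C are the crossings of I with J, I with K and J with K, and sign zero marks
the upper strand. In the order listed, the strands from top to bottom are IJK, IKJ, KIJ, KJI, JKI,
JIK. -/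
theorem sign_pattern {a b c : AlphaV}
    (hS : (some a, some b, some c) ∈ AlphaV.weldedTriples) : ∃ e : SignType, e ≠ 0 ∧
    ((a.fstSign = 0 ∧ a.sndSign = e ∧ b.fstSign = 0 ∧ b.sndSign = e ∧
        c.fstSign = 0 ∧ c.sndSign = e) ∨
      (a.fstSign = 0 ∧ a.sndSign = e ∧ b.fstSign = 0 ∧ b.sndSign = e ∧
        c.fstSign = -e ∧ c.sndSign = 0) ∨
      (a.fstSign = 0 ∧ a.sndSign = e ∧ b.fstSign = -e ∧ b.sndSign = 0 ∧
        c.fstSign = -e ∧ c.sndSign = 0) ∨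
      (a.fstSign = -e ∧ a.sndSign = 0 ∧ b.fstSign = -e ∧ b.sndSign = 0 ∧
        c.fstSign = -e ∧ c.sndSign = 0) ∨
      (a.fstSign = -e ∧ a.sndSign = 0 ∧ b.fstSign = -e ∧ b.sndSign = 0 ∧
        c.fstSign = 0 ∧ c.sndSign = e) ∨
      (a.fstSign = -e ∧ a.sndSign = 0 ∧ b.fstSign = 0 ∧ b.sndSign = e ∧
        c.fstSign = 0 ∧ c.sndSign = e)) := by
  simp only [AlphaV.weldedTriples, Set.mem_insert_iff, Set.mem_singleton_iff, Prod.mk.injEq,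
    Option.some.injEq, reduceCtorEq, and_false, false_and, or_false] at hS
  rcases hS with ⟨rfl, rfl, rfl⟩ | ⟨rfl, rfl, rfl⟩ | ⟨rfl, rfl, rfl⟩ | ⟨rfl, rfl, rfl⟩ |
    ⟨rfl, rfl, rfl⟩ | ⟨rfl, rfl, rfl⟩ | ⟨rfl, rfl, rfl⟩ | ⟨rfl, rfl, rfl⟩ | ⟨rfl, rfl, rfl⟩ |
    ⟨rfl, rfl, rfl⟩ | ⟨rfl, rfl, rfl⟩ | ⟨rfl, rfl, rfl⟩
  all_goals first
    | exact ⟨1, by decide, by decide⟩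
    | exact ⟨-1, by decide, by decide⟩

set_option maxHeartbeats 2000000 in
/-- The effect of the third move (with three letters) on the values of the letters. -/
theorem exists_swap_values {G : Type*} [Group G] {g : Fin n → G}
    (hg : ∀ k, CommutesWithConjugates (g k)) {L : Type*} [DecidableEq L] {I J K : Fin n}
    {A B C : L} (hAB : A ≠ B) (hAC : A ≠ C) (hBC : B ≠ C) (s : Fin n → L → SignType)
    (o : Fin n → L → Prop) {a b c : AlphaV}
    (hS : (some a, some b, some c) ∈ AlphaV.weldedTriples) (hIK : I = K → I = J)
    (hA : (I = J ∧ s I A = 0 ∧ ¬ o I A) ∨ (I ≠ J ∧ s I A = a.fstSign ∧ s J A = a.sndSign ∧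
      (o I A ↔ a.fstSign = 0) ∧ (o J A ↔ a.sndSign = 0)))
    (hB : (I = K ∧ s I B = 0 ∧ ¬ o I B) ∨ (I ≠ K ∧ s I B = b.fstSign ∧ s K B = b.sndSign ∧
      (o I B ↔ b.fstSign = 0) ∧ (o K B ↔ b.sndSign = 0)))
    (hC : (J = K ∧ s J C = 0 ∧ ¬ o J C) ∨ (J ≠ K ∧ s J C = c.fstSign ∧ s K C = c.sndSign ∧
      (o J C ↔ c.fstSign = 0) ∧ (o K C ↔ c.sndSign = 0)))
    (P : (L → G) → ∀ k, G ⧸ Subgroup.normalClosure {g k} → L → Prop)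
    (hP : ∀ m k q X, P m k q X ↔ (o k X → m X = conjBy (g k) q))
    (v : (L → G) → ∀ k, L → G ⧸ Subgroup.normalClosure {g k})
    (hv : ∀ m k X, v m k X = ((m X ^ ((s k X : SignType) : ℤ) : G) : G ⧸ _))
    (m : L → G) (hI : ∃ q, Scan (P m I) (v m I) q [A, B])
    (hJ : ∃ q, Scan (P m J) (v m J) q [A, C]) (hK : ∃ q, Scan (P m K) (v m K) q [B, C]) :
    ∃ m' : L → G, (∀ X, X ≠ A → X ≠ B → X ≠ C → m' X = m X) ∧
      (([A, B].map (v m I)).prod = ([B, A].map (v m' I)).prod ∧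
        ∀ q, Scan (P m I) (v m I) q [A, B] → Scan (P m' I) (v m' I) q [B, A]) ∧
      (([A, C].map (v m J)).prod = ([C, A].map (v m' J)).prod ∧
        ∀ q, Scan (P m J) (v m J) q [A, C] → Scan (P m' J) (v m' J) q [C, A]) ∧
      (([B, C].map (v m K)).prod = ([C, B].map (v m' K)).prod ∧
        ∀ q, Scan (P m K) (v m K) q [B, C] → Scan (P m' K) (v m' K) q [C, B]) := by
  simp only [Scan, and_true, hP, hv, List.map_cons, List.map_nil, List.prod_cons, List.prod_nil,
    mul_one] at hI hJ hK ⊢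
  obtain ⟨qI, hI⟩ := hI
  obtain ⟨qJ, hJ⟩ := hJ
  obtain ⟨qK, hK⟩ := hK
  obtain ⟨e, he, hS⟩ := sign_pattern hS
  generalize a.fstSign = fa at *
  generalize a.sndSign = sa at *
  generalize b.fstSign = fb at *
  generalize b.sndSign = sb at *
  generalize c.fstSign = fc at *
  generalize c.sndSign = sc at *
  have hE : ((-e : SignType) : ℤ) = -((e : SignType) : ℤ) := by simp
  have hne : -e ≠ 0 := by simpa using he
  have conj1 : ∀ Y W : L, ∀ X, X ≠ Y →
    Function.update m Y (m W ^ ((e : SignType) : ℤ) * m Y * (m W ^ ((e : SignType) : ℤ))⁻¹) X = m X :=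
      fun Y W X h => Function.update_of_ne h _ _
  have conj2 : ∀ Y W : L, ∀ X, X ≠ Y →
    Function.update m Y ((m W ^ ((e : SignType) : ℤ))⁻¹ * m Y * (m W ^ ((e : SignType) : ℤ))) X = m X :=
      fun Y W X h => Function.update_of_ne h _ _
  generalize hEe : ((e : SignType) : ℤ) = E at *
  have commL : ∀ k q r, conjBy (g k) q ^ E * (conjBy (g k) r * (conjBy (g k) q ^ E)⁻¹) =
      conjBy (g k) r := fun k q r => by
    rw [← mul_assoc, (((hg k).commute_conjBy q r).zpow_left E).eq, mul_inv_cancel_right]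
  have commR : ∀ k q r, (conjBy (g k) q ^ E)⁻¹ * (conjBy (g k) r * conjBy (g k) q ^ E) =
      conjBy (g k) r := fun k q r => by
    rw [← (((hg k).commute_conjBy q r).zpow_left E).eq, inv_mul_cancel_left]
  have conjL : ∀ k q (y : G), conjBy (g k) (q * (y : G ⧸ _) ^ E) =
      (y ^ E)⁻¹ * (conjBy (g k) q * y ^ E) := fun k q y => by
    rw [← QuotientGroup.mk_zpow, (hg k).conjBy_mul, mul_assoc]
  have conjR : ∀ k q (y : G), conjBy (g k) (q * ((y : G ⧸ _) ^ E)⁻¹) =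
      y ^ E * (conjBy (g k) q * (y ^ E)⁻¹) := fun k q y => by
    rw [← QuotientGroup.mk_zpow, ← QuotientGroup.mk_inv, (hg k).conjBy_mul, mul_assoc, _root_.inv_inv]
  have commM : ∀ k j q r, ((conjBy (g k) q : G) : G ⧸ Subgroup.normalClosure {g j}) ^ E *
      ((conjBy (g k) r : G) : G ⧸ Subgroup.normalClosure {g j}) ^ E =
      ((conjBy (g k) r : G) : G ⧸ Subgroup.normalClosure {g j}) ^ E *
        ((conjBy (g k) q : G) : G ⧸ Subgroup.normalClosure {g j}) ^ E := fun k j q r => by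
    simp only [← QuotientGroup.mk_zpow, ← QuotientGroup.mk_mul]
    rw [(((hg k).commute_conjBy q r).zpow_zpow E E).eq]
  have commI : ∀ k j q r, (((conjBy (g k) q : G) : G ⧸ Subgroup.normalClosure {g j}) ^ E)⁻¹ *
      (((conjBy (g k) r : G) : G ⧸ Subgroup.normalClosure {g j}) ^ E)⁻¹ =
      (((conjBy (g k) r : G) : G ⧸ Subgroup.normalClosure {g j}) ^ E)⁻¹ *
        (((conjBy (g k) q : G) : G ⧸ Subgroup.normalClosure {g j}) ^ E)⁻¹ := fun k j q r => by
    rw [← mul_inv_rev, ← mul_inv_rev, commM]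
  clear hP hv
  -- The move changes only the value of the crossing between the two lower strands: it is conjugated
  -- by the meridian of the top strand, which is the value of either crossing with the top strand.
  -- If two blocks lie in one component, a letter joining them has no prescribed value, so the
  -- conjugator must be the other crossing. Conjugating a contribution by conjugates of g_k is
  -- invisible modulo the normal closure of g_k.
  rcases hA with ⟨rfl, hA⟩ | ⟨hIJ, hA⟩
  · rcases hC with ⟨rfl, hC⟩ | ⟨hJK, hC⟩
    -- All three blocks are in one component: all signs are zero and nothing is prescribed.
    · refine ⟨m, fun _ _ _ _ => rfl, ?_⟩
      simp_all
    · have hB' := hB.resolve_left (fun h => hJK h.1)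
      clear hB
      rcases hS with ⟨rfl, rfl, rfl, rfl, rfl, rfl⟩ | ⟨rfl, rfl, rfl, rfl, rfl, rfl⟩ |
        ⟨rfl, rfl, rfl, rfl, rfl, rfl⟩ | ⟨rfl, rfl, rfl, rfl, rfl, rfl⟩ |
        ⟨rfl, rfl, rfl, rfl, rfl, rfl⟩ | ⟨rfl, rfl, rfl, rfl, rfl, rfl⟩
      · refine ⟨_, fun X _ _ h => conj1 C B X h, ?_⟩
        simp_all [Ne.symm, mul_assoc, mk_conjBy, mul_zpow_mul_inv, inv_mul_zpow_mul]
      · refine ⟨_, fun X _ _ h => conj1 C B X h, ?_⟩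
        simp_all [Ne.symm, mul_assoc, mk_conjBy, mul_zpow_mul_inv, inv_mul_zpow_mul]
      · refine ⟨_, fun X h _ _ => conj1 A B X h, ?_⟩
        simp_all [Ne.symm, mul_assoc, mk_conjBy, mul_zpow_mul_inv, inv_mul_zpow_mul]
      · refine ⟨_, fun X h _ _ => conj1 A B X h, ?_⟩
        simp_all [Ne.symm, mul_assoc, mk_conjBy, mul_zpow_mul_inv, inv_mul_zpow_mul]
      -- The top strand is J, and `A` has no prescribed value because I = J; so `C` conjugates.
      · refine ⟨_, fun X _ h _ => conj2 B C X h, ?_⟩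
        simp_all [Ne.symm, mul_assoc, mk_conjBy, mul_zpow_mul_inv, inv_mul_zpow_mul]
      · refine ⟨_, fun X _ h _ => conj2 B C X h, ?_⟩
        simp_all [Ne.symm, mul_assoc, mk_conjBy, mul_zpow_mul_inv, inv_mul_zpow_mul]
  · have hB' := hB.resolve_left (fun h => hIJ (hIK h.1))
    clear hB
    rcases hC with ⟨rfl, hC⟩ | ⟨hJK, hC⟩
    all_goals
      rcases hS with ⟨rfl, rfl, rfl, rfl, rfl, rfl⟩ | ⟨rfl, rfl, rfl, rfl, rfl, rfl⟩ |
        ⟨rfl, rfl, rfl, rfl, rfl, rfl⟩ | ⟨rfl, rfl, rfl, rfl, rfl, rfl⟩ |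
        ⟨rfl, rfl, rfl, rfl, rfl, rfl⟩ | ⟨rfl, rfl, rfl, rfl, rfl, rfl⟩
      · refine ⟨_, fun X _ _ h => conj1 C B X h, ?_⟩
        simp_all [Ne.symm, mul_assoc, mk_conjBy, mul_zpow_mul_inv, inv_mul_zpow_mul]
      · refine ⟨_, fun X _ _ h => conj1 C B X h, ?_⟩
        simp_all [Ne.symm, mul_assoc, mk_conjBy, mul_zpow_mul_inv, inv_mul_zpow_mul]
      · refine ⟨_, fun X h _ _ => conj1 A B X h, ?_⟩
        simp_all [Ne.symm, mul_assoc, mk_conjBy, mul_zpow_mul_inv, inv_mul_zpow_mul]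
      · refine ⟨_, fun X h _ _ => conj1 A B X h, ?_⟩
        simp_all [Ne.symm, mul_assoc, mk_conjBy, mul_zpow_mul_inv, inv_mul_zpow_mul]
      -- The top strand is J again, but now `C` may lie within one component (J = K), while `A` does
      -- not; so `A` conjugates.
      · refine ⟨_, fun X _ h _ => conj2 B A X h, ?_⟩
        simp_all [Ne.symm, mul_assoc, mk_conjBy, mul_zpow_mul_inv, inv_mul_zpow_mul]
      · refine ⟨_, fun X _ h _ => conj2 B A X h, ?_⟩
        simp_all [Ne.symm, mul_assoc, mk_conjBy, mul_zpow_mul_inv, inv_mul_zpow_mul]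

end Nanophrase

/-! ### The third move: phrases -/

namespace Nanophrase

open Token

variable {n : ℕ}

theorem sign_cases (p : Nanophrase.{u} AlphaV n) {I J : Fin n} {A : p.Letter} (hIJ : I ≤ J)
    (hA : A ∈ p.word I) (hA' : A ∈ p.word J) (h2 : I = J → 2 ≤ (p.word I).count A) :
    (I = J ∧ p.sign I A = 0 ∧ ¬ p.IsOver I A) ∨
      (I ≠ J ∧ p.sign I A = (p.proj A).fstSign ∧ p.sign J A = (p.proj A).sndSign ∧
        (p.IsOver I A ↔ (p.proj A).fstSign = 0) ∧ (p.IsOver J A ↔ (p.proj A).sndSign = 0)) := by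
  rcases eq_or_lt_of_le hIJ with rfl | hlt
  · have h := sign_eq_zero_of_two_le (h2 rfl)
    exact .inl ⟨rfl, p.sign_eq_zero_of_forall h, fun ⟨_, j, hj, hAj⟩ => hj (h j hAj)⟩
  · have e1 := p.sign_fst hA' hlt
    have e2 := p.sign_snd hA hA' hlt
    refine .inr ⟨hlt.ne, e1, e2, ?_, ?_⟩
    · rw [← e1]; exact ⟨fun h => h.1, fun h => ⟨h, J, hlt.ne', hA'⟩⟩
    · rw [← e2]; exact ⟨fun h => h.1, fun h => ⟨h, I, hlt.ne, hA⟩⟩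

theorem sign_fst_eq_zero (p : Nanophrase.{u} AlphaV n) {I J : Fin n} {A : p.Letter} (hIJ : I ≤ J)
    (hA : A ∈ p.word I) (hA' : A ∈ p.word J) (h2 : I = J → 2 ≤ (p.word I).count A)
    (h : (p.proj A).fstSign = 0) : p.sign I A = 0 := by
  rcases p.sign_cases hIJ hA hA' h2 with h' | h'
  · exact h'.2.1
  · exact h'.2.1.trans h

theorem sign_snd_eq_zero (p : Nanophrase.{u} AlphaV n) {I J : Fin n} {A : p.Letter} (hIJ : I ≤ J)
    (hA : A ∈ p.word I) (hA' : A ∈ p.word J) (h2 : I = J → 2 ≤ (p.word I).count A)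
    (h : (p.proj A).sndSign = 0) : p.sign J A = 0 := by
  rcases p.sign_cases hIJ hA hA' h2 with h' | h'
  · exact h'.1 ▸ h'.2.1
  · exact h'.2.2.1.trans h

/-- A piece of the component `k` can be replaced by another one if the values of the letters change
from `m` to `m'`. -/
def PieceTransfers {G : Type*} [Group G] (p : Nanophrase.{u} AlphaV n) (g : Fin n → G)
    (m m' : p.Letter → G) (k : Fin n) (b b' : List p.Letter) : Prop :=
  (b.map (p.valClass g m k)).prod = (b'.map (p.valClass g m' k)).prod ∧
    ∀ q, Scan (p.OverCondition g m k) (p.valClass g m k) q b →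
      Scan (p.OverCondition g m' k) (p.valClass g m' k) q b'

theorem PieceTransfers.swap {G : Type*} [Group G] {p : Nanophrase.{u} AlphaV n} {g : Fin n → G}
    {m : p.Letter → G} {k : Fin n} {A B : p.Letter} (hA : p.sign k A = 0) (hB : p.sign k B = 0) :
    p.PieceTransfers g m m k [A, B] [B, A] := by
  simp only [PieceTransfers, List.map_cons, List.map_nil, valClass_eq_one hA, valClass_eq_one hB,
    Scan, mul_one, and_true, true_and]
  exact fun q h => h.symm

theorem PieceTransfers.refl {G : Type*} [Group G] {p : Nanophrase.{u} AlphaV n} {g : Fin n → G}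
    {m : p.Letter → G} {k : Fin n} {b : List p.Letter} : p.PieceTransfers g m m k b b :=
  ⟨rfl, fun _ h => h⟩

/-- Reordering the letters at up to three places of a phrase. -/
theorem transfersTo_reorder (p : Nanophrase.{u} AlphaV n) (w' : Fin n → List p.Letter)
    (hw' : IsGauss w') {b₁ b₁' b₂ b₂' b₃ b₃' : List p.Letter}
    (hb₁ : b₁.Perm b₁') (hb₂ : b₂.Perm b₂') (hb₃ : b₃.Perm b₃') {x y z t : List (Token p.Letter)}
    (hp : flatPhrase p.word =
      x ++ b₁.map letter ++ y ++ b₂.map letter ++ z ++ b₃.map letter ++ t)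
    (hp' : flatPhrase w' = x ++ b₁'.map letter ++ y ++ b₂'.map letter ++ z ++ b₃'.map letter ++ t)
    {I J K : Fin n} (hI : (I : ℕ) = bars x) (hJ : (J : ℕ) = bars x + bars y)
    (hK : (K : ℕ) = bars x + bars y + bars z)
    (h : ∀ (G : Type) [Group G] (g : Fin n → G), (∀ k, CommutesWithConjugates (g k)) →
      ∀ m : p.Letter → G, p.IsColoring g m → ∃ m' : p.Letter → G,
        (∀ X, X ∈ letters x ∨ X ∈ letters y ∨ X ∈ letters z ∨ X ∈ letters t → m' X = m X) ∧
        p.PieceTransfers g m m' I b₁ b₁' ∧ p.PieceTransfers g m m' J b₂ b₂' ∧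
        p.PieceTransfers g m m' K b₃ b₃') :
    TransfersTo p ⟨p.Letter, p.proj, w', hw'⟩ := by
  intro G _ g hg m hm
  have e : ∀ k, p.word k = _ := fun k => (component_flatPhrase p.word k).symm.trans
    (component_eq_of_flat hp hI hJ (.inr hK) k)
  have e' : ∀ k, w' k = _ := fun k => (component_flatPhrase w' k).symm.trans
    (component_eq_of_flat hp' hI hJ (.inr hK) k)
  obtain ⟨m', hm', h1, h2, h3⟩ := h G g hg m hm
  have hmem : ∀ k X, X ∈ w' k ↔ X ∈ p.word k := by
    intro k X
    rw [e, e']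
    have hif : ∀ (I : Fin n) (b b' : List p.Letter), b.Perm b' →
        (X ∈ (if I = k then b' else []) ↔ X ∈ (if I = k then b else [])) := by
      intro I b b' hb
      split_ifs
      · exact hb.symm.mem_iff
      · rfl
    simp only [List.mem_append, hif _ _ _ hb₁, hif _ _ _ hb₂, hif _ _ _ hb₃]
  have hsign : ∀ k X, X ∈ w' k →
      (⟨p.Letter, p.proj, w', hw'⟩ : Nanophrase AlphaV n).sign k X = p.sign k X := fun k X _ =>
    sign_transfer (p := p) (p' := ⟨p.Letter, p.proj, w', hw'⟩) id rfl (fun k => hmem k X) k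
  have hX : ∀ k X, X ∈ component 0 x (k : Fin n) ∨ X ∈ component (bars x) y k ∨
      X ∈ component (bars x + bars y) z k ∨ X ∈ component (bars x + bars y + bars z) t k →
      m' X = m X := fun k X h => hm' X (h.imp mem_letters_of_mem_component
        (.imp mem_letters_of_mem_component (.imp mem_letters_of_mem_component
          mem_letters_of_mem_component)))
  have key := fun k => scan_replace (P := p.OverCondition g m k) (P' := p.OverCondition g m' k)
    (v := p.valClass g m k) (v' := p.valClass g m' k)
    (fun A hA q h => by simpa only [OverCondition, hX k A hA] using h)
    (fun A hA => by simp only [valClass, val, hX k A hA])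
    (fun hk => by subst hk; exact h1) (fun hk => by subst hk; exact h2)
    (fun hk => by subst hk; exact h3) (e k) (e' k) (hm k)
  refine ⟨m', fun k => ?_, fun k => ?_⟩
  · exact scan_transfer (p := p) (p' := ⟨p.Letter, p.proj, w', hw'⟩) id hmem hsign k (by
      change Scan _ _ 1 ((w' k).map id)
      rw [List.map_id]
      exact (key k).1)
  · have := prod_transfer (p := p) (g := g) (m := m') (p' := ⟨p.Letter, p.proj, w', hw'⟩) id hsign k
    rw [(key k).2]
    simpa using this.symm

set_option maxHeartbeats 1000000 in
-- With three letters, `exists_swap_values` supplies the new values. With one empty letter, the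
-- triple forces the two occurrences that trade places to have sign zero, so neither affects the
-- partial product at the other and no value changes.
theorem transfersTo_h3 (p : Nanophrase.{u} AlphaV n) (w' : Fin n → List p.Letter)
    (hw' : IsGauss w') (A B C : Option p.Letter)
    (hS : (A.map p.proj, B.map p.proj, C.map p.proj) ∈ AlphaV.weldedTriples)
    (x y z t : List (Token p.Letter))
    (hp : flatPhrase p.word =
      x ++ Token.ofOption A ++ Token.ofOption B ++ y ++ Token.ofOption A ++ Token.ofOption C ++
        z ++ Token.ofOption B ++ Token.ofOption C ++ t)
    (hp' : flatPhrase w' =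
      x ++ Token.ofOption B ++ Token.ofOption A ++ y ++ Token.ofOption C ++ Token.ofOption A ++
        z ++ Token.ofOption C ++ Token.ofOption B ++ t) :
    TransfersTo p ⟨p.Letter, p.proj, w', hw'⟩ := by
  have hq : flatPhrase p.word = x ++ (A.toList ++ B.toList).map letter ++ y ++
      (A.toList ++ C.toList).map letter ++ z ++ (B.toList ++ C.toList).map letter ++ t := by
    rw [hp]; simp [ofOption_eq]
  have hq' : flatPhrase w' = x ++ (B.toList ++ A.toList).map letter ++ y ++
      (C.toList ++ A.toList).map letter ++ z ++ (C.toList ++ B.toList).map letter ++ t := by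
    rw [hp']; simp [ofOption_eq]
  -- No triple has two empty entries, so each block contains a letter; this bounds the number of
  -- bars before it and yields its component.
  have hne : A.toList ++ B.toList ≠ [] ∧ A.toList ++ C.toList ≠ [] ∧ B.toList ++ C.toList ≠ [] := by
    cases A <;> cases B <;> cases C <;> simp [AlphaV.weldedTriples] at hS ⊢
  obtain ⟨I, hI⟩ : ∃ I : Fin n, (I : ℕ) = bars x :=
    ⟨⟨_, lt_of_flat (w := p.word) (x := x) hne.1
      (t := y ++ (A.toList ++ C.toList).map letter ++ z ++ (B.toList ++ C.toList).map letter ++ t)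
      (by rw [hq]; simp)⟩, rfl⟩
  obtain ⟨J, hJ⟩ : ∃ J : Fin n, (J : ℕ) = bars x + bars y :=
    ⟨⟨_, lt_of_flat (w := p.word) (x := x ++ (A.toList ++ B.toList).map letter ++ y) hne.2.1
      (t := z ++ (B.toList ++ C.toList).map letter ++ t) (by rw [hq]; simp)⟩,
      by simp [bars_append, bars_map_letter, -List.map_append]⟩
  obtain ⟨K, hK⟩ : ∃ K : Fin n, (K : ℕ) = bars x + bars y + bars z :=
    ⟨⟨_, lt_of_flat (w := p.word) (x := x ++ (A.toList ++ B.toList).map letter ++ y ++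
      (A.toList ++ C.toList).map letter ++ z) hne.2.2 (t := t) (by rw [hq])⟩,
      by simp [bars_append, bars_map_letter, -List.map_append, add_assoc]⟩
  have hIJ : I ≤ J := by rw [Fin.le_def]; omega
  have hJK : J ≤ K := by rw [Fin.le_def]; omega
  have e : ∀ k, p.word k = _ := fun k => (component_flatPhrase p.word k).symm.trans
    (component_eq_of_flat hq hI hJ (.inr hK) k)
  refine transfersTo_reorder p w' hw' List.perm_append_comm List.perm_append_comm
    List.perm_append_comm hq hq' hI hJ hK ?_
  intro G _ g hg m hm
  have hcount : ∀ X, _ := fun X => count_letters_flatPhrase p.gauss X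
  have hsJ := exists_scan_of_replace (e J) (hm J)
  have hsI := (exists_scan_of_replace (e I) (hm I)).1 rfl
  have hsK := (exists_scan_of_replace (e K) (hm K)).2.2 rfl
  replace hsJ := hsJ.2.1 rfl
  rw [hq] at hcount
  simp only [letters_append, letters_map_letter, List.count_append] at hcount
  match A, B, C, hS with
  | some A, some B, some C, hS =>
    simp only [Option.toList_some, List.cons_append, List.nil_append, List.count_cons,
      List.count_nil] at hcount e hsI hsJ hsK ⊢
    have hA := hcount A
    have hB := hcount B
    have hC := hcount C
    simp only [beq_self_eq_true, if_true] at hA hB hC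
    have hAB : A ≠ B := by
      rintro rfl; simp only [beq_self_eq_true, if_true] at hA; omega
    have hAC : A ≠ C := by
      rintro rfl; simp only [beq_self_eq_true, if_true] at hA; omega
    have hBC : B ≠ C := by
      rintro rfl; simp only [beq_self_eq_true, if_true] at hB; omega
    have notMem : ∀ {X} {l : List p.Letter}, l.count X = 0 → X ∉ l :=
      fun h => List.count_eq_zero.1 h
    obtain ⟨m', hm', h⟩ := exists_swap_values hg hAB hAC hBC p.sign p.IsOver hS
      (fun h => le_antisymm hIJ (h ▸ hJK))
      (p.sign_cases hIJ (by rw [e]; simp) (by rw [e]; simp)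
        (by rintro rfl; rw [e]; simp [List.count_cons]; omega))
      (p.sign_cases (hIJ.trans hJK) (by rw [e]; simp) (by rw [e]; simp)
        (by rintro rfl; rw [e]; simp [List.count_cons]; omega))
      (p.sign_cases hJK (by rw [e]; simp) (by rw [e]; simp)
        (by rintro rfl; rw [e]; simp [List.count_cons]; omega))
      (p.OverCondition g) (fun _ _ _ _ => Iff.rfl) (p.valClass g) (fun _ _ _ => rfl) m hsI hsJ hsK
    refine ⟨m', fun X hX => hm' X ?_ ?_ ?_, h⟩
    all_goals
      rintro rfl
      rcases hX with hX | hX | hX | hX <;>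
        (have := List.count_pos_iff.2 hX; omega)
  | none, some B, some C, hS =>
    simp only [Option.toList_some, Option.toList_none, List.cons_append, List.nil_append] at e ⊢
    have hs : (p.proj B).sndSign = 0 ∧ (p.proj C).sndSign = 0 := by
      simp only [Option.map_some, Option.map_none] at hS
      generalize p.proj B = b at hS ⊢
      generalize p.proj C = c at hS ⊢
      revert hS
      cases b <;> cases c <;> simp [AlphaV.weldedTriples, AlphaV.sndSign]
    refine ⟨m, fun _ _ => rfl, .refl, .refl, .swap ?_ ?_⟩
    · exact p.sign_snd_eq_zero (hIJ.trans hJK) (by rw [e]; simp) (by rw [e]; simp)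
        (by rintro rfl; rw [e]; simp [List.count_cons]; omega) hs.1
    · exact p.sign_snd_eq_zero hJK (by rw [e]; simp) (by rw [e]; simp)
        (by rintro rfl; rw [e]; simp [List.count_cons]; omega) hs.2
  | some A, none, some C, hS =>
    simp only [Option.toList_some, Option.toList_none, List.cons_append, List.nil_append] at e ⊢
    have hs : (p.proj A).sndSign = 0 ∧ (p.proj C).fstSign = 0 := by
      simp only [Option.map_some, Option.map_none] at hS
      generalize p.proj A = a at hS ⊢
      generalize p.proj C = c at hS ⊢
      revert hS
      cases a <;> cases c <;> simp [AlphaV.weldedTriples, AlphaV.fstSign, AlphaV.sndSign]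
    refine ⟨m, fun _ _ => rfl, .refl, .swap ?_ ?_, .refl⟩
    · exact p.sign_snd_eq_zero hIJ (by rw [e]; simp) (by rw [e]; simp)
        (by rintro rfl; rw [e]; simp [List.count_cons]; omega) hs.1
    · exact p.sign_fst_eq_zero hJK (by rw [e]; simp) (by rw [e]; simp)
        (by rintro rfl; rw [e]; simp [List.count_cons]; omega) hs.2
  | some A, some B, none, hS =>
    simp only [Option.toList_some, Option.toList_none, List.cons_append, List.nil_append] at e ⊢
    have hs : (p.proj A).fstSign = 0 ∧ (p.proj B).fstSign = 0 := by
      simp only [Option.map_some, Option.map_none] at hS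
      generalize p.proj A = a at hS ⊢
      generalize p.proj B = b at hS ⊢
      revert hS
      cases a <;> cases b <;> simp [AlphaV.weldedTriples, AlphaV.fstSign]
    refine ⟨m, fun _ _ => rfl, .swap ?_ ?_, .refl, .refl⟩
    · exact p.sign_fst_eq_zero hIJ (by rw [e]; simp) (by rw [e]; simp)
        (by rintro rfl; rw [e]; simp [List.count_cons]; omega) hs.1
    · exact p.sign_fst_eq_zero (hIJ.trans hJK) (by rw [e]; simp) (by rw [e]; simp)
        (by rintro rfl; rw [e]; simp [List.count_cons]; omega) hs.2
  | none, none, _, hS => simp [AlphaV.weldedTriples] at hS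
  | none, _, none, hS => simp [AlphaV.weldedTriples] at hS
  | _, none, none, hS => simp [AlphaV.weldedTriples] at hS

end Nanophrase

namespace Nanophrase

variable {n : ℕ}

/-! ### Lower sequences -/

theorem mem_lowerSequences {s e : List (Fin n)} : e ∈ lowerSequences s ↔
    2 ≤ e.length ∧ ∃ d, d.Sublist s ∧ d.length < s.length ∧ e.IsRotated d := by
  simp only [lowerSequences, List.mem_toFinset, List.mem_filter, List.mem_flatMap,
    List.mem_sublists, List.mem_cyclicPermutations_iff, decide_eq_true_eq]
  constructor
  · rintro ⟨⟨d, ⟨h1, h2⟩, h3⟩, h4⟩; exact ⟨h4, d, h1, h2, h3⟩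
  · rintro ⟨h4, d, h1, h2, h3⟩; exact ⟨⟨d, ⟨h1, h2⟩, h3⟩, h4⟩

/-- Write the rotation as an exchange of two pieces; the sublist splits accordingly, and its pieces
can be exchanged back. -/
theorem exists_sublist_isRotated {α : Type*} {d e f : List α} (h1 : f.Sublist e)
    (h2 : e.IsRotated d) : ∃ f', f'.Sublist d ∧ f.IsRotated f' := by
  obtain ⟨k, hk, rfl⟩ := List.isRotated_iff_mod.1 h2.symm
  rw [List.rotate_eq_drop_append_take hk] at h1
  obtain ⟨a, b, rfl, ha, hb⟩ := List.sublist_append_iff.1 h1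
  refine ⟨b ++ a, ?_, List.isRotated_append⟩
  have := hb.append ha
  rwa [List.take_append_drop] at this

theorem lowerSequences_trans {s e f : List (Fin n)} (he : e ∈ lowerSequences s)
    (hf : f ∈ lowerSequences e) : f ∈ lowerSequences s ∧ f.length < e.length := by
  rw [mem_lowerSequences] at he hf ⊢
  obtain ⟨-, d, hd, hds, hed⟩ := he
  obtain ⟨hf2, d', hd', hde, hfd⟩ := hf
  obtain ⟨f', hf', hdf⟩ := exists_sublist_isRotated hd' hed
  have l1 := hfd.perm.length_eq
  have l2 := hdf.perm.length_eq
  have l3 := hed.perm.length_eq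
  exact ⟨⟨hf2, f', hf'.trans hd, by omega, hfd.trans hdf⟩, by omega⟩

theorem nodup_of_mem_lowerSequences {s e : List (Fin n)} (hs : s.Nodup)
    (he : e ∈ lowerSequences s) : e.Nodup := by
  obtain ⟨-, d, hd, -, hed⟩ := mem_lowerSequences.1 he
  exact hed.nodup_iff.2 (hd.nodup hs)

theorem muSeq_append (p : Nanophrase.{u} AlphaV n) (d : List (Fin n)) (i : Fin n) :
    p.muSeq (d ++ [i]) = p.mu d i := by
  simp [muSeq]

/-! ### Comparing the invariants -/

/-- The coefficients for `p` and `p'` agree modulo every number that divides the lower ones. -/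
def MuCongruent (p p' : Nanophrase.{u} AlphaV n) : Prop :=
  ∀ (c : List (Fin n)) (i : Fin n), (c ++ [i]).Nodup → c ≠ [] → ∀ N : ℕ,
    (∀ e ∈ lowerSequences (c ++ [i]), (N : ℤ) ∣ p.muSeq e ∧ (N : ℤ) ∣ p'.muSeq e) →
      (p.mu c i : ZMod N) = p'.mu c i

theorem MuCongruent.symm {p p' : Nanophrase.{u} AlphaV n} (h : MuCongruent p p') :
    MuCongruent p' p :=
  fun c i hn hc N hN => (h c i hn hc N fun e he => (hN e he).symm).symm

/-- Strong induction on the length of the sequence: its own lower sequences are shorter and also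
lower for `s`, so `N` divides their values for both phrases, and the congruence modulo `N` applies
to the sequence itself. -/
theorem MuCongruent.dvd {p p' : Nanophrase.{u} AlphaV n} (h : MuCongruent p p')
    {s : List (Fin n)} (hs : s.Nodup) {N : ℕ}
    (hN : ∀ e ∈ lowerSequences s, (N : ℤ) ∣ p.muSeq e) :
    ∀ e ∈ lowerSequences s, (N : ℤ) ∣ p'.muSeq e := by
  intro e he
  induction hl : e.length using Nat.strong_induction_on generalizing e with
  | _ l ih =>
    have he2 := (mem_lowerSequences.1 he).1
    have hne : e ≠ [] := by rintro rfl; simp at he2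
    obtain ⟨d, i, rfl⟩ : ∃ d i, e = d ++ [i] := ⟨_, _, (List.dropLast_append_getLast hne).symm⟩
    have hd : d ≠ [] := by rintro rfl; simp at he2
    have hcong := h d i (nodup_of_mem_lowerSequences hs he) hd N fun f hf => by
      obtain ⟨h1, h2⟩ := lowerSequences_trans he hf
      exact ⟨hN f h1, ih f.length (by omega) f h1 rfl⟩
    have := hN _ he
    rw [muSeq_append] at this ⊢
    rw [← ZMod.intCast_zmod_eq_zero_iff_dvd] at this ⊢
    rw [← hcong, this]

/-- Take N = |Δ|. By `MuCongruent.dvd` the two gcds divide each other, hence are equal, and then the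
congruence applies at this modulus. The value N = 0 is allowed and means equality of integers. -/
theorem MuCongruent.mubar_eq {p p' : Nanophrase.{u} AlphaV n} (h : MuCongruent p p')
    {c : List (Fin n)} {i : Fin n} (hn : (c ++ [i]).Nodup) (hc : c ≠ []) :
    p.mubar c i = p'.mubar c i := by
  have key : ∀ p p' : Nanophrase.{u} AlphaV n, MuCongruent p p' →
      p.delta c i ∣ p'.delta c i := by
    intro p p' h
    refine Finset.dvd_gcd fun e he => ?_
    rw [← Int.natAbs_dvd]
    refine h.dvd hn (fun e he => ?_) e he
    rw [Int.natAbs_dvd]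
    exact Finset.gcd_dvd he
  have hdelta : p.delta c i = p'.delta c i :=
    dvd_antisymm_of_normalize_eq Finset.normalize_gcd Finset.normalize_gcd
      (key p p' h) (key p' p h.symm)
  have hmu : p.mu c i ≡ p'.mu c i [ZMOD p.delta c i] := by
    have := h c i hn hc (p.delta c i).natAbs fun e he =>
      ⟨by rw [Int.natAbs_dvd]; exact Finset.gcd_dvd he,
        by rw [Int.natAbs_dvd, hdelta]; exact Finset.gcd_dvd he⟩
    rw [ZMod.intCast_eq_intCast_iff, Int.modEq_iff_dvd, Int.natAbs_dvd] at this
    exact Int.modEq_iff_dvd.2 this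
  ext m
  simp only [mubar, Set.mem_ofPred_eq, ← hdelta]
  exact ⟨fun hm => hm.trans hmu, fun hm => hm.trans hmu.symm⟩

/-! ### Colorings by unitriangular matrices -/

section Meridian

variable {c : List (Fin n)} (hc : c.Nodup) {N : ℕ} {p p' : Nanophrase.{u} AlphaV n}

theorem commutesWithConjugates_meridian (k : Fin n) :
    CommutesWithConjugates (meridian (ZMod N) hc k) :=
  commute_conj_meridian hc k

/-- The value of the component `k`. -/
def longitude {G : Type*} [Group G] (p : Nanophrase.{u} AlphaV n) (m : p.Letter → G)
    (k : Fin n) : G := ((p.word k).map (p.val m k)).prod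

theorem prod_valClass {G : Type*} [Group G] {g : Fin n → G} {m : p.Letter → G} (k : Fin n)
    (l : List p.Letter) : (l.map (p.valClass g m k)).prod =
      (((l.map (p.val m k)).prod : G) : G ⧸ Subgroup.normalClosure {g k}) := by
  rw [← QuotientGroup.mk'_apply, map_list_prod, List.map_map]; rfl

/-- The link between colorings and the invariants: for large q the word given by ρ^q has the
longitude as its value, and its coefficients have reached their limits. -/
theorem longitude_apply {m : p.Letter → unitriangular c (ZMod N) 1}
    (hm : p.IsColoring (meridian (ZMod N) hc) m) (k : Fin n) {a b : Fin (c.length + 1)}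
    (hab : a ≤ b) : ((p.longitude m k : unitriangular c (ZMod N) 1) : (GapMatrix c (ZMod N))ˣ).val a b =
      ((p.mu (gapInterval c a b) k : ℤ) : ZMod N) := by
  obtain ⟨d, hd⟩ := hm.eval_component (commutesWithConjugates_meridian hc)
  rw [longitude, ← hd (max d (c.length + 2)) (le_max_left _ _) k, eval_meridian_apply hc _ _ _ hab,
    ← p.expansion_eq_mu _ _ (max d (c.length + 2)) (by omega)]
  · rfl
  · rw [length_gapInterval c (by omega)]; omega

theorem longitude_apply_zero_last {m : p.Letter → unitriangular c (ZMod N) 1}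
    (hm : p.IsColoring (meridian (ZMod N) hc) m) (k : Fin n) :
    ((p.longitude m k : unitriangular c (ZMod N) 1) : (GapMatrix c (ZMod N))ˣ).val 0 (Fin.last _) =
      ((p.mu c k : ℤ) : ZMod N) := by
  rw [longitude_apply hc hm k (Fin.zero_le _)]
  simp [gapInterval]

theorem exists_coloring (p : Nanophrase.{u} AlphaV n) :
    ∃ m, p.IsColoring (meridian (ZMod N) hc) m := by
  obtain ⟨d, hd⟩ := p.exists_isColoring_approxValue (meridian (ZMod N) hc)
    (commutesWithConjugates_meridian hc)
  exact ⟨_, hd d le_rfl⟩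

/-- As `i` is not in `c`, its meridian is 1 and the normal closure is trivial, so the longitudes of
`i` coincide, and with them their upper right entries. -/
theorem TransfersTo.muCongruent (h : p.TransfersTo p') : MuCongruent p p' := by
  intro c i hn _ N _
  have hc : c.Nodup := (List.nodup_append.1 hn).1
  have hi : i ∉ c := fun h => by
    have := (List.nodup_append.1 hn).2.2 i h i (by simp)
    exact this rfl
  obtain ⟨m, hm⟩ := exists_coloring hc (N := N) p
  obtain ⟨m', hm', hL⟩ := h _ _ (commutesWithConjugates_meridian hc) m hm
  rw [← longitude_apply_zero_last hc hm, ← longitude_apply_zero_last hc hm']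
  have := hL i
  rw [prod_valClass, prod_valClass, QuotientGroup.eq, meridian_eq_one hc hi] at this
  have e : Subgroup.normalClosure {(1 : unitriangular c (ZMod N) 1)} = ⊥ := by
    rw [eq_bot_iff]
    exact Subgroup.normalClosure_le_normal (by simp)
  rw [e, Subgroup.mem_bot, inv_mul_eq_one] at this
  rw [longitude, longitude, this]

/-- If the lower coefficients vanish, the value of each component commutes with its meridian. -/
theorem commute_longitude {m : p.Letter → unitriangular c (ZMod N) 1}
    (hm : p.IsColoring (meridian (ZMod N) hc) m) {i : Fin n}
    (hN : ∀ e ∈ lowerSequences (c ++ [i]), (N : ℤ) ∣ p.muSeq e) (k : Fin n) :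
    Commute (meridian (ZMod N) hc k) (p.longitude m k) := by
  set Z := ((p.longitude m k : unitriangular c (ZMod N) 1) : (GapMatrix c (ZMod N))ˣ).val - 1 with hZ
  -- The coefficient of `d` in component `k` belongs to the sequence `d ++ [k]`, a rotation of `k ::
  -- d`. In either case it is a lower sequence, shorter than `c ++ [i]` because `i` is missing. This
  -- makes both products of κ_k with `Z` vanish.
  have hlow : ∀ d : List (Fin n), d ≠ [] → (k :: d).Sublist c ∨ (d ++ [k]).Sublist c →
      ((p.mu d k : ℤ) : ZMod N) = 0 := by
    intro d hd h
    rw [ZMod.intCast_zmod_eq_zero_iff_dvd, ← muSeq_append]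
    apply hN
    rw [mem_lowerSequences]
    have hl : 0 < d.length := List.length_pos_iff.2 hd
    refine ⟨by simp; omega, ?_⟩
    rcases h with h | h
    · refine ⟨k :: d, h.trans (List.sublist_append_left _ _), ?_, ?_⟩
      · have := h.length_le; simp at this ⊢; omega
      · exact List.isRotated_append (l := d) (l' := [k])
    · refine ⟨d ++ [k], h.trans (List.sublist_append_left _ _), ?_, List.IsRotated.refl _⟩
      have := h.length_le; simp at this ⊢; omega
  have hsupp : Supported (fun d => ¬ (k :: d).Sublist c ∧ ¬ (d ++ [k]).Sublist c) Z := by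
    intro a b hab
    have hdeg := (p.longitude m k).2.1 a b hab
    refine ⟨hdeg.1, ?_⟩
    change ¬ _ ∧ ¬ _
    rw [← not_or]
    intro h
    have hne : gapInterval c a b ≠ [] := by
      intro h0
      have := hdeg.2
      rw [h0] at this
      simp at this
    have hlt : a ≠ b := by
      rintro rfl
      exact hne (List.drop_eq_nil_of_le (by simp))
    rw [hZ, Matrix.sub_apply, Matrix.one_apply_ne hlt, sub_zero, longitude_apply hc hm k hdeg.1] at hab
    exact hab (hlow _ hne h)
  have e1 : kappa c (ZMod N) k * Z = 0 :=
    (Supported.mul (W := fun d => ¬ d.Sublist c) (by rintro x y rfl hy; exact hy.1)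
      (supported_kappa k) hsupp).eq_zero fun d hd h => h hd
  have e2 : Z * kappa c (ZMod N) k = 0 :=
    (Supported.mul (W := fun d => ¬ d.Sublist c) (by rintro x y hx rfl; exact hx.2)
      hsupp (supported_kappa k)).eq_zero fun d hd h => h hd
  have e3 : ((p.longitude m k : unitriangular c (ZMod N) 1) : (GapMatrix c (ZMod N))ˣ).val = 1 + Z := by rw [hZ]; abel
  refine Subtype.ext (Units.ext ?_)
  rw [Subgroup.coe_mul, Subgroup.coe_mul, Units.val_mul, Units.val_mul, coe_meridian]
  rw [e3]
  simp only [mul_add, add_mul, e1, e2, mul_one, one_mul]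
  abel

/-- The effect of conjugating the meridians, if the lower coefficients vanish. -/
theorem eval_conj_meridian_apply (hne : c ≠ []) (x : Fin n → unitriangular c (ZMod N) 1)
    (w : SignedWord (Fin n))
    (hw : ∀ d : List (Fin n), d.Sublist c → d ≠ [] → d ≠ c → ((NCSeries.phi w d : ℤ) : ZMod N) = 0) :
    ∃ Z : GapMatrix c (ZMod N), DegreeGE c.length Z ∧
      Z 0 (Fin.last _) = ((NCSeries.phi w c : ℤ) : ZMod N) ∧
      ((SignedWord.eval (fun k => (x k)⁻¹ * meridian (ZMod N) hc k * x k) w :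
        unitriangular c (ZMod N) 1) : (GapMatrix c (ZMod N))ˣ).val = 1 + Z := by
  set T : Fin n → GapMatrix c (ZMod N) := fun k => conjKappa (x k) k with hT
  have hcast : ∀ (z : ℤ) (Y : GapMatrix c (ZMod N)), (z : GapMatrix c (ZMod N)) * Y =
      (z : ZMod N) • Y := by
    intro z Y
    rw [← zsmul_eq_mul, Int.cast_smul_eq_zsmul]
  refine ⟨((NCSeries.phi w c : ℤ) : ZMod N) • (c.map T).prod, ?_, ?_, ?_⟩
  · have h : ∀ d : List (Fin n), DegreeGE d.length (d.map T).prod := by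
      intro d
      induction d with
      | nil => exact supported_one (Nat.zero_le _)
      | cons k d ih =>
        rw [List.map_cons, List.prod_cons, List.length_cons, add_comm]
        exact DegreeGE.mul ((supported_conjKappa (x k) k).mono fun y hy => by
          simpa using hy.length_le) ih
    intro a b hab
    exact h c a b fun h0 => hab (by rw [Matrix.smul_apply, h0, smul_zero])
  -- Conjugation does not change the leading term. By telescoping, the products along `c` differ
  -- only in degree greater than `c.length`, hence not at all.
  · have hdiff : ∀ k, DegreeGE 2 (T k - kappa c (ZMod N) k) := by
      intro k
      have e : T k - kappa c (ZMod N) k =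
          ((((x k)⁻¹ : unitriangular c (ZMod N) 1) : (GapMatrix c (ZMod N))ˣ).val - 1) *
            (kappa c (ZMod N) k * ((x k : (GapMatrix c (ZMod N))ˣ).val)) +
          kappa c (ZMod N) k * ((x k : (GapMatrix c (ZMod N))ˣ).val - 1) := by
        simp only [hT, conjKappa]; noncomm_ring
      have hk : DegreeGE 1 (kappa c (ZMod N) k) := (supported_kappa k).mono (by rintro _ rfl; simp)
      rw [e]
      exact Supported.add (DegreeGE.mul (d := 1) (e := 1) ((x k)⁻¹).2.1
        (DegreeGE.mul (d := 1) (e := 0) hk (degreeGE_zero_of_mem (x k).2)))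
        (DegreeGE.mul (d := 1) (e := 1) hk (x k).2.1)
    have hprod : ∀ d : List (Fin n), DegreeGE (d.length + 1)
        ((d.map T).prod - (d.map (kappa c (ZMod N))).prod) ∧
        DegreeGE d.length (d.map (kappa c (ZMod N))).prod := by
      intro d
      induction d with
      | nil => exact ⟨by simp [supported_zero], supported_one (Nat.zero_le _)⟩
      | cons k d ih =>
        have hk : DegreeGE 1 (kappa c (ZMod N) k) :=
          (supported_kappa k).mono (by rintro _ rfl; simp)
        have hTk : DegreeGE 1 (T k) := (supported_conjKappa (x k) k).mono fun y hy => by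
          simpa using hy.length_le
        rw [List.map_cons, List.prod_cons, List.map_cons, List.prod_cons, List.length_cons]
        refine ⟨?_, by rw [add_comm]; exact DegreeGE.mul hk ih.2⟩
        have e : T k * (d.map T).prod - kappa c (ZMod N) k * (d.map (kappa c (ZMod N))).prod =
            T k * ((d.map T).prod - (d.map (kappa c (ZMod N))).prod) +
            (T k - kappa c (ZMod N) k) * (d.map (kappa c (ZMod N))).prod := by noncomm_ring
        rw [e]
        refine Supported.add ?_ ?_
        · have := DegreeGE.mul hTk ih.1
          rwa [show 1 + (d.length + 1) = d.length + 1 + 1 by omega] at this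
        · have := DegreeGE.mul (hdiff k) ih.2
          rwa [show 2 + d.length = d.length + 1 + 1 by omega] at this
    have := (hprod c).1.eq_zero (Nat.lt_succ_self _)
    rw [sub_eq_zero] at this
    rw [this, Matrix.smul_apply, prod_kappa, if_pos ⟨Fin.zero_le _, by simp [gapInterval]⟩]
    simp
  · have h := NCSeries.eval_eq_sum c hc T
      (fun k => (((x k)⁻¹ * meridian (ZMod N) hc k * x k : unitriangular c (ZMod N) 1) :
        (GapMatrix c (ZMod N))ˣ))
      (fun k => coe_conj_meridian hc (x k) k) (fun k => coe_conj_meridian_inv hc (x k) k)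
      (prod_eq_zero_of_supported _ fun k => supported_conjKappa (x k) k) w
    have e := SignedWord.map_eval (unitriangular c (ZMod N) 1).subtype
      (fun k => (x k)⁻¹ * meridian (ZMod N) hc k * x k) w
    simp only [Subgroup.subtype_apply] at e
    -- The coefficients of all other sublists vanish by `hw`.
    rw [e, h, ← Finset.sum_subset (s₁ := {[], c})]
    · rw [Finset.sum_pair hne.symm, hcast, hcast]
      simp [NCSeries.phi_nil_apply]
    · intro d hd
      simp only [Finset.mem_insert, Finset.mem_singleton] at hd
      rcases hd with rfl | rfl <;> simp
    · intro d hd hd'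
      simp only [List.mem_toFinset, List.mem_sublists, Finset.mem_insert, Finset.mem_singleton,
        not_or] at hd hd'
      rw [hcast, hw d hd hd'.1 hd'.2, zero_smul]

end Meridian

end Nanophrase

namespace Nanophrase

variable {n : ℕ}

/-! ### The shift move -/

theorem _root_.CommutesWithConjugates.conj {G : Type*} [Group G] {a : G} (ha : CommutesWithConjugates a)
    (y : G) : CommutesWithConjugates (y⁻¹ * a * y) := by
  intro x
  have := ha.commute_conjBy (y * x : G) (y : G)
  rw [ha.conjBy_mk, ha.conjBy_mk] at this
  convert this using 1
  group

section Shift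

variable (p : Nanophrase.{u} AlphaV n) {proj' : p.Letter → AlphaV} {k : Fin n} {A : p.Letter}
  {x : List p.Letter} {w' : Fin n → List p.Letter} (hw' : IsGauss w')

theorem mem_shift (hk : p.word k = A :: x) (hk' : w' = Function.update p.word k (x ++ [A]))
    (j : Fin n) (X : p.Letter) : X ∈ w' j ↔ X ∈ p.word j := by
  subst hk'
  by_cases hj : j = k
  · subst hj; simp [hk, or_comm]
  · rw [Function.update_of_ne hj]

/-- The only letter whose projection may change occurs twice in the component `k`, so its sign is
zero before and after. -/
theorem sign_shift (hk : p.word k = A :: x) (hk' : w' = Function.update p.word k (x ++ [A]))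
    (hproj : ∀ X, X ≠ A ∨ A ∉ x → proj' X = p.proj X) {j : Fin n} {X : p.Letter} (hX : X ∈ w' j) :
    (⟨p.Letter, proj', w', hw'⟩ : Nanophrase AlphaV n).sign j X = p.sign j X := by
  have hmem := mem_shift p hk hk'
  by_cases h : X ≠ A ∨ A ∉ x
  · exact sign_transfer (p := p) (p' := ⟨p.Letter, proj', w', hw'⟩) id (hproj X h)
      (fun j => hmem j X) j
  · push Not at h
    obtain ⟨rfl, hx⟩ := h
    have h2 : 2 ≤ (p.word k).count X := by
      rw [hk, List.count_cons_self]
      have := List.count_pos_iff.2 hx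
      omega
    have hj := sign_eq_zero_of_two_le h2
    obtain rfl := hj j ((hmem j X).1 hX)
    rw [p.sign_eq_zero_of_forall hj]
    exact sign_eq_zero_of_forall ⟨p.Letter, proj', w', hw'⟩ fun i hi => hj i ((hmem i X).1 hi)

variable {G : Type*} [Group G] {m : p.Letter → G}

theorem longitude_shift (hk : p.word k = A :: x) (hk' : w' = Function.update p.word k (x ++ [A]))
    (hproj : ∀ X, X ≠ A ∨ A ∉ x → proj' X = p.proj X) (j : Fin n) :
    longitude (⟨p.Letter, proj', w', hw'⟩ : Nanophrase AlphaV n) m j =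
      if j = k then (p.val m k A)⁻¹ * p.longitude m k * p.val m k A else p.longitude m j := by
  have e : longitude (⟨p.Letter, proj', w', hw'⟩ : Nanophrase AlphaV n) m j =
      ((w' j).map (p.val m j)).prod := by
    unfold longitude
    congr 1
    refine List.map_congr_left fun X hX => ?_
    rw [val, val, sign_shift p hw' hk hk' hproj hX]
  rw [e, hk']
  split_ifs with hj
  · subst hj
    simp [longitude, hk]
  · rw [Function.update_of_ne hj]; rfl

/-- Moving the base point past `A` removes the factor E contributed by `A` from the left of the
later partial products in `k`; replacing g_k by E⁻¹ g_k E compensates for this without changing any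
value. -/
theorem isColoring_shift {g g' : Fin n → G} (hg : ∀ j, CommutesWithConjugates (g j))
    (hg' : ∀ j, g' j = if j = k then (p.val m k A)⁻¹ * g k * p.val m k A else g j)
    (hk : p.word k = A :: x) (hk' : w' = Function.update p.word k (x ++ [A]))
    (hproj : ∀ X, X ≠ A ∨ A ∉ x → proj' X = p.proj X) (hm : p.IsColoring g m)
    (hcomm : p.IsOver k A → Commute (g k) (p.longitude m k)) :
    IsColoring (⟨p.Letter, proj', w', hw'⟩ : Nanophrase AlphaV n) g' m := by
  have hmem := mem_shift p hk hk'
  have hgc : ∀ j, CommutesWithConjugates (g' j) := by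
    intro j
    rw [hg']
    split_ifs
    · exact (hg k).conj _
    · exact hg j
  rw [isColoring_iff hg] at hm
  rw [isColoring_iff hgc]
  intro j (x' : List p.Letter) (B : p.Letter) (y' : List p.Letter) hj hB
  change w' j = x' ++ B :: y' at hj
  have hBj : B ∈ w' j := by rw [hj]; simp
  have hB' : p.IsOver j B := by
    rwa [isOver_transfer (p := p) (p' := ⟨p.Letter, proj', w', hw'⟩) id
      (sign_shift p hw' hk hk' hproj hBj) (fun i => hmem i B)] at hB
  have e : (x'.map (val (⟨p.Letter, proj', w', hw'⟩ : Nanophrase AlphaV n) m j)).prod =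
      (x'.map (p.val m j)).prod := by
    congr 1
    refine List.map_congr_left fun X hX => ?_
    rw [val, val, sign_shift p hw' hk hk' hproj (by rw [hj]; simp [hX])]
  rw [e, hg']
  by_cases hjk : j = k
  · subst hjk
    rw [if_pos rfl]
    rw [hk', Function.update_self] at hj
    -- If nothing follows, the occurrence is the moved letter, now preceded by the whole rest of the
    -- component. It contributes 1, so the new condition asks that conjugation by the longitude fix
    -- g_k.
    rcases List.eq_nil_or_concat y' with rfl | ⟨y'', C, rfl⟩
    · obtain ⟨rfl, hAB⟩ := List.append_inj' hj rfl
      obtain rfl : A = B := by simpa using hAB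
      have h1 := hm j [] A x hk hB'
      have h2 := (hcomm hB').eq
      have hv : p.val m j A = 1 := by simp [val, hB'.1]
      simp only [longitude, hk, List.map_cons, List.prod_cons, hv, one_mul] at h2
      simp only [List.map_nil, List.prod_nil, inv_one, one_mul, mul_one] at h1
      rw [hv, h1, inv_one, one_mul, mul_one, mul_assoc, h2, inv_mul_cancel_left]
    · rw [List.concat_eq_append, ← List.cons_append, ← List.append_assoc] at hj
      obtain ⟨rfl, -⟩ := List.append_inj' hj rfl
      rw [hm j (A :: x') B y'' hk hB', List.map_cons, List.prod_cons]
      group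
  · rw [if_neg hjk]
    rw [hk', Function.update_of_ne hjk] at hj
    exact hm j x' B y' hj hB'

end Shift

/-- The same values color the new phrase over conjugated meridians. Modulo `N`, its longitude of `i`
is then 1 plus a multiple of the top monomial, with the coefficient that unconjugated meridians
would give. -/
theorem muCongruent_shift (p : Nanophrase.{u} AlphaV n) {proj' : p.Letter → AlphaV} {k : Fin n}
    {A : p.Letter} {x : List p.Letter} {w' : Fin n → List p.Letter} (hw' : IsGauss w')
    (hk : p.word k = A :: x) (hk' : w' = Function.update p.word k (x ++ [A]))
    (hproj : ∀ X, X ≠ A ∨ A ∉ x → proj' X = p.proj X) :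
    MuCongruent p ⟨p.Letter, proj', w', hw'⟩ := by
  intro c i hn hne N hN
  have hc : c.Nodup := (List.nodup_append.1 hn).1
  set p' : Nanophrase.{u} AlphaV n := ⟨p.Letter, proj', w', hw'⟩ with hp'
  obtain ⟨m, hm⟩ := exists_coloring hc (N := N) p
  have hlong := longitude_shift p hw' hk hk' hproj (m := m)
  set y : Fin n → unitriangular c (ZMod N) 1 := fun j => if j = k then p.val m k A else 1 with hy
  have hg' : ∀ j, (y j)⁻¹ * meridian (ZMod N) hc j * y j = if j = k then
      (p.val m k A)⁻¹ * meridian (ZMod N) hc k * p.val m k A else meridian (ZMod N) hc j := by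
    intro j
    simp only [hy]
    split_ifs with h
    · rw [h]
    · simp
  have hcol := isColoring_shift p hw' (commutesWithConjugates_meridian hc) hg' hk hk' hproj hm
    fun _ => commute_longitude hc hm (fun e he => (hN e he).1) k
  obtain ⟨d, hd⟩ := hcol.eval_component fun j => (commutesWithConjugates_meridian hc j).conj (y j)
  set q := max d (c.length + 2)
  have hphi : ∀ e : List (Fin n), e.Sublist c →
      NCSeries.phi (p'.etaWord (p'.rho q (p'.signedWord i (p'.word i)))) e = p'.mu e i :=
    fun e he => p'.expansion_eq_mu e i q (by omega) (by have := he.length_le; omega)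
  obtain ⟨Z, hZ, hZc, hval⟩ := eval_conj_meridian_apply hc hne y
    (p'.etaWord (p'.rho q (p'.signedWord i (p'.word i)))) fun e he h1 h2 => by
      rw [hphi e he, ZMod.intCast_zmod_eq_zero_iff_dvd, ← muSeq_append]
      refine (hN _ ?_).2
      rw [mem_lowerSequences]
      have hl : 0 < e.length := List.length_pos_iff.2 h1
      refine ⟨by simp; omega, e ++ [i], he.append (List.Sublist.refl _), ?_, List.IsRotated.refl _⟩
      have h3 := he.length_le
      have h4 : e.length ≠ c.length := fun h => h2 (he.eq_of_length h)
      simp; omega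
  rw [hphi c (List.Sublist.refl c)] at hZc
  rw [hd q (le_max_left _ _) i] at hval
  change ((longitude p' m i : unitriangular c (ZMod N) 1) : (GapMatrix c (ZMod N))ˣ).val = _ at hval
  rw [← hZc, ← longitude_apply_zero_last hc hm]
  have h0 : (0 : Fin (c.length + 1)) ≠ Fin.last _ := by
    have := List.length_pos_iff.2 hne
    rw [ne_eq, Fin.ext_iff]; simp; omega
  suffices h : ((p.longitude m i : unitriangular c (ZMod N) 1) : (GapMatrix c (ZMod N))ˣ).val =
      1 + Z by
    rw [h, Matrix.add_apply, Matrix.one_apply_ne h0, zero_add]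
  by_cases hik : i = k
  · set E := p.val m k A
    have e : p.longitude m i = E * longitude p' m i * E⁻¹ := by
      rw [hlong, if_pos hik, hik]; group
    -- If `i` is the shifted component, the longitude is conjugated by `E`; but `Z` has the top
    -- degree, so 1 + Z is central.
    have e1 : ((E : (GapMatrix c (ZMod N))ˣ).val - 1) * Z = 0 :=
      DegreeGE.eq_zero (d := 1 + c.length) (by omega) (DegreeGE.mul E.2.1 hZ)
    have e2 : Z * (((E⁻¹ : unitriangular c (ZMod N) 1) : (GapMatrix c (ZMod N))ˣ).val - 1) = 0 :=
      DegreeGE.eq_zero (d := c.length + 1) (by omega) (DegreeGE.mul hZ (E⁻¹).2.1)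
    have e3 : (E : (GapMatrix c (ZMod N))ˣ).val *
        ((E⁻¹ : unitriangular c (ZMod N) 1) : (GapMatrix c (ZMod N))ˣ).val = 1 := by
      rw [← Units.val_mul, ← Subgroup.coe_mul]; simp
    rw [sub_mul, one_mul, sub_eq_zero] at e1
    rw [mul_sub, mul_one, sub_eq_zero] at e2
    rw [e, Subgroup.coe_mul, Subgroup.coe_mul, Units.val_mul, Units.val_mul, hval, mul_add,
      mul_one, add_mul, e1, e2, e3]
  · rw [← hval, hlong, if_neg hik]

theorem _root_.ExtMMove.muCongruent {p p' : Nanophrase.{u} AlphaV n} (h : ExtMMove weldedData p p') :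
    MuCongruent p p' := by
  cases h with
  | iso _ _ f hproj hword => exact (transfersTo_iso f hproj hword).muCongruent
  | h1 _ _ A f hproj x y hp hp' => exact (transfersTo_h1 A f hproj x y hp hp').muCongruent
  | h2 _ _ A B hτ f hproj x y z hp hp' =>
    exact (transfersTo_h2 A B hτ f hproj x y z hp hp').muCongruent
  | h3 L proj w w' hw hw' A B C hS x y z t hp hp' =>
    exact (transfersTo_h3 ⟨L, proj, w, hw⟩ w' hw' A B C hS x y z t hp hp').muCongruent
  | selfCrossing L proj w hw k A x y z hk =>
    exact (transfersTo_selfCrossing L proj w hw k A x y z hk _).muCongruent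
  | shift L proj w w' hw hw' k A x hk hk' =>
    refine muCongruent_shift ⟨L, proj, w, hw⟩ hw' hk hk' fun X hX => ?_
    split_ifs with h
    · exact Function.update_of_ne (hX.resolve_right fun h' => h' h) _ _
    · rfl

end Nanophrase

/-- A residue class, as a set of integers, determines its modulus up to sign, so equality of the
sets contains the equality of the nonnegative numbers Δ as well as the congruence of the μ. -/
theorem theorem8p2 {n : ℕ} (p p' : Nanophrase.{u} AlphaV n) (h : ExtMHomotopic weldedData p p')
    (c : List (Fin n)) (i : Fin n) (hc : c ≠ []) (hdistinct : (c ++ [i]).Nodup) :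
    p.mubar c i = p'.mubar c i := by
  induction h with
  | rel p p' h => exact h.muCongruent.mubar_eq hdistinct hc
  | refl p => rfl
  | symm p p' _ ih => exact ih.symm
  | trans p p' p'' _ _ ih ih' => exact ih.trans ih'
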